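/- **Conventions.** $I=[0,1]$, and $E^I$ is the space of paths in $E$ with the compact-open topology. For a map $p\colon E\to B$ and $r\ge 2$, let $$E^I_B=\{\gamma\in E^I\mid p\circ\gamma \text{ is constant}\},\qquad E^r_B=\{(e_1,\dots,e_r)\in E^r\mid p(e_i)=p(e_j)\ \text{for all } i,j\},$$ $$\Pi_r\colon E^I_B\to E^r_B,\qquad \Pi_r(\gamma)=\Bigl(\gamma(0),\gamma\bigl(\tfrac1{r-1}\bigr),\dots,\gamma\bigl(\tfrac{r-2}{r-1}\bigr),\gamma(1)\Bigr).$$ The sequential parametrized topological complexity $\mathrm{TC}_r[p\colon E\to B]\in\{0,1,2,\dots,\infty\}$ is the smallest $m$ such that $E^r_B$ is covered by $m+1$ open sets over each of which $\Pi_r$ has a continuous section. If $E$ is a metric space, give $E^I_B$ the uniform metric and let $\mathcal B_k(E^I_B)$ be the space of probability measures on $E^I_B$ supported on at most $k$ points, with the Lévy–Prokhorov metric; the sequential parametrized distributional complexity $\mathrm{dTC}_r[p\colon E\to B]\in\{0,1,2,\dots,\infty\}$ is the smallest $m$ for which there is a continuous map $s\colon E^r_B\to\mathcal B_{m+1}(E^I_B)$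 with $\operatorname{supp}s(e)\subseteq\Pi_r^{-1}(e)$ for all $e\in E^r_B$. Let $SO(n)$ act on $\mathbb R^{n+1}$ through $A\mapsto\begin{bmatrix}A&0\\0&1\end{bmatrix}$ and on $\mathbb RP^n$ by $g\cdot[v]=[gv]$. For a (locally trivial) principal $SO(n)$-bundle $q\colon P\to B$ with $P\neq\emptyset$, its $\mathbb RP^n$-associate is $p\colon \mathbb RP^n\times_{SO(n)}P\to P/SO(n)$, $[x,y]\mapsto[y]$, where $\mathbb RP^n\times_{SO(n)}P$ is the quotient of $\mathbb RP^n\times P$ by the diagonal action. **Proposition.** For each $r\ge 2$ there exists $n_r\in\mathbb N$ such that, for every $n>n_r$ and every principal $SO(n)$-bundle $P\to B$ with $P\ne\emptyset$ for which $\mathbb RP^n\times_{SO(n)}P$ is metrizable, and for every metric inducing its topology, $$\mathrm{dTC}_r[p\colon\mathbb RP^n\times_{SO(n)}P\to P/SO(n)]<\mathrm{TC}_r[p\colon\mathbb RP^n\times_{SO(n)}P\to P/SO(n)].$$ Moreover, for all $r\ge2$ and $n\ge1$ and all such bundles, $$\mathrm{dTC}_r[p\colon\mathbb RP^n\times_{SO(n)}P\to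 P/SO(n)]\le 2^{2r-2}-1\quad\text{and}\quad \mathrm{TC}_r[p\colon\mathbb RP^n\times_{SO(n)}P\to P/SO(n)]\ge n(r-1).$$ -/

import Mathlib

open MeasureTheory Set
open scoped unitInterval LinearAlgebra.Projectivization Matrix

noncomputable section

/-! ### Sectional category -/

/-- The sectional category of `p : E → B`: the smallest `n` such that `B` is covered by `n + 1`
open sets over each of which `p` has a continuous section (`⊤` if there is no such `n`). -/
def secat {E B : Type*} [TopologicalSpace E] [TopologicalSpace B] (p : E → B) : ℕ∞ :=
  sInf {m : ℕ∞ | ∃ n : ℕ, m = n ∧ ∃ U : Fin (n + 1) → Set B,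
    (∀ i, IsOpen (U i)) ∧ (⋃ i, U i) = univ ∧
      ∀ i, ∃ s : C(U i, E), ∀ x : U i, p (s x) = x}

/-! ### Finitely supported probability measures -/

/-- The set underlying `𝓑ₖ(X)`: Borel probability measures on `X` supported on at most `k` points,
that is, measures `∑ aᵢ xᵢ` with at most `k` summands. -/
def FinProb (k : ℕ) (X : Type*) [TopologicalSpace X] : Type _ :=
  {μ : @ProbabilityMeasure X (borel X) //
    ∃ F : Finset X, F.card ≤ k ∧ (@ProbabilityMeasure.toMeasure X (borel X) μ) (↑F : Set X)ᶜ = 0}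

/-- The support of a finitely supported probability measure: the points of positive mass. -/
def FinProb.supp {k : ℕ} {X : Type*} [TopologicalSpace X] (μ : FinProb k X) : Set X :=
  {x | 0 < (@ProbabilityMeasure.toMeasure X (borel X) μ.1) {x}}

/-- A measure in `𝓑ₖ(X)` as a point of the Lévy--Prokhorov space of probability measures. -/
def FinProb.toLP {k : ℕ} {X : Type*} [MetricSpace X] (μ : FinProb k X) :
    LevyProkhorov (@ProbabilityMeasure X (borel X)) :=
  ⟨μ.1⟩

/-- `𝓑ₖ(X)` carries the topology of the Lévy--Prokhorov metric. -/
instance FinProb.instTopologicalSpace {k : ℕ} {X : Type*} [MetricSpace X] :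
    TopologicalSpace (FinProb k X) :=
  letI : MeasurableSpace X := borel X
  haveI : BorelSpace X := ⟨rfl⟩
  TopologicalSpace.induced FinProb.toLP inferInstance

/-! ### Distributional sectional category -/

/-- The distributional sectional category of `p : E → B`, with `E` a metric space: the smallest `n`
such that there is a continuous `s : B → 𝓑ₙ₊₁(E)` with `supp (s b) ⊆ p⁻¹(b)` for every `b`
(`⊤` if there is no such `n`). -/
def dsecat {E B : Type*} [MetricSpace E] [TopologicalSpace B] (p : E → B) : ℕ∞ :=
  sInf {m : ℕ∞ | ∃ n : ℕ, m = n ∧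
    ∃ s : C(B, FinProb (n + 1) E), ∀ b, (s b).supp ⊆ p ⁻¹' {b}}

/-! ### Sequential parametrized complexities -/

/-- `E^I_B`: the paths in `E` lying in a single fibre of `p`. As a subspace of `C(I, E)` it carries
the compact-open topology and, if `E` is a metric space, the uniform metric. -/
abbrev FiberwisePath {E B : Type*} [TopologicalSpace E] (p : E → B) : Type _ :=
  {γ : C(I, E) // ∃ b, ∀ t, p (γ t) = b}

/-- `E^r_B`: the `r`-tuples of points of `E` lying in a single fibre of `p`. -/
abbrev FiberProduct {E B : Type*} (r : ℕ) (p : E → B) : Type _ :=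
  {e : Fin r → E // ∀ i j, p (e i) = p (e j)}

/-- The times `0, 1/(r-1), …, (r-2)/(r-1), 1`. -/
def sampleTime (r : ℕ) (i : Fin r) : I :=
  ⟨(i : ℝ) / ((r : ℝ) - 1), by
    have h : (i : ℝ) + 1 ≤ r := by exact_mod_cast i.2
    have h0 : (0 : ℝ) ≤ i := Nat.cast_nonneg _
    exact ⟨div_nonneg h0 (by linarith), div_le_one_of_le₀ (by linarith) (by linarith)⟩⟩

/-- `Π_r : E^I_B → E^r_B`, evaluation at the times `i/(r-1)`. -/
def endpointMap {E B : Type*} [TopologicalSpace E] (r : ℕ) (p : E → B) (γ : FiberwisePath p) :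
    FiberProduct r p :=
  ⟨fun i => γ.1 (sampleTime r i), fun i j => by
    obtain ⟨b, hb⟩ := γ.2
    rw [hb, hb]⟩

/-- The `r`-th sequential parametrized topological complexity `TC_r[p : E → B]`. -/
def parametrizedTC {E B : Type*} [TopologicalSpace E] (r : ℕ) (p : E → B) : ℕ∞ :=
  secat (endpointMap r p)

/-- The `r`-th sequential parametrized distributional complexity `dTC_r[p : E → B]`,
for `E` a metric space. -/
def parametrizedDTC {E B : Type*} [MetricSpace E] (r : ℕ) (p : E → B) : ℕ∞ :=
  dsecat (endpointMap r p)

/-! ### Principal and associated bundles -/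

/-- `q : P → B` is a principal `G`-bundle: the (left) action of `G` on `P` preserves the fibres of
`q`, and `q` is locally isomorphic to `U × G → U` with `G` acting by translation on the factor
`G`. (Continuity and freeness of the action and surjectivity and continuity of `q` follow.) -/
structure IsPrincipalBundle (G : Type*) {P B : Type*} [Group G] [TopologicalSpace G]
    [TopologicalSpace P] [TopologicalSpace B] [MulAction G P] (q : P → B) : Prop where
  proj_smul : ∀ (g : G) (x : P), q (g • x) = q x
  locally_trivial : ∀ b : B, ∃ e : Bundle.Trivialization G q, b ∈ e.baseSet ∧
    ∀ (g : G) (x : P), q x ∈ e.baseSet → (e (g • x)).2 = g * (e x).2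

/-- `F ×_G P = (F × P) / G`, the quotient by the diagonal action (with the quotient topology). -/
abbrev AssocBundle (G F P : Type*) [Group G] [MulAction G F] [MulAction G P] : Type _ :=
  Quotient (MulAction.orbitRel G (F × P))

/-- The projection `F ×_G P → P / G` of the associated bundle, `[f, x] ↦ [x]`. -/
def assocProj (G F P : Type*) [Group G] [MulAction G F] [MulAction G P] :
    AssocBundle G F P → Quotient (MulAction.orbitRel G P) :=
  Quotient.map Prod.snd (by
    rintro a b ⟨g, rfl⟩
    exact ⟨g, rfl⟩)

/-! ### The action of `SO(n)` on `ℝPⁿ` -/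

/-- The special orthogonal group `SO(n)`, with the topology of matrices. -/
abbrev SO (n : ℕ) : Type := Matrix.specialOrthogonalGroup (Fin n) ℝ

/-- Real projective `n`-space: the lines through the origin in `ℝⁿ⁺¹`. -/
def RP (n : ℕ) : Type := ℙ ℝ (Fin (n + 1) → ℝ)

/-- `ℝPⁿ` carries the quotient topology from `ℝⁿ⁺¹ ∖ {0}`. -/
instance (n : ℕ) : TopologicalSpace (RP n) :=
  inferInstanceAs (TopologicalSpace (Quotient (projectivizationSetoid ℝ (Fin (n + 1) → ℝ))))

/-- The block matrix with diagonal blocks `A` and `1`, for an `n × n` matrix `A`. -/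
def blockEmb {n : ℕ} (A : Matrix (Fin n) (Fin n) ℝ) : Matrix (Fin (n + 1)) (Fin (n + 1)) ℝ :=
  Matrix.reindex finSumFinEquiv finSumFinEquiv
    (Matrix.fromBlocks A 0 0 (1 : Matrix (Fin 1) (Fin 1) ℝ))

theorem blockEmb_one {n : ℕ} : blockEmb (1 : Matrix (Fin n) (Fin n) ℝ) = 1 := by
  simp [blockEmb, Matrix.fromBlocks_one]

theorem blockEmb_mul {n : ℕ} (A A' : Matrix (Fin n) (Fin n) ℝ) :
    blockEmb (A * A') = blockEmb A * blockEmb A' := by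
  simp [blockEmb, Matrix.fromBlocks_multiply, Matrix.submatrix_mul_equiv]

/-- The linear action of `SO(n)` on `ℝⁿ⁺¹`, fixing the last coordinate. -/
def soLin {n : ℕ} (g : SO n) : (Fin (n + 1) → ℝ) →ₗ[ℝ] (Fin (n + 1) → ℝ) :=
  Matrix.toLin' (blockEmb (g : Matrix (Fin n) (Fin n) ℝ))

theorem soLin_one {n : ℕ} : soLin (1 : SO n) = LinearMap.id := by
  simp [soLin, blockEmb_one]

theorem soLin_mul {n : ℕ} (g h : SO n) : soLin (g * h) = soLin g ∘ₗ soLin h := by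
  simp [soLin, blockEmb_mul, Matrix.toLin'_mul]

theorem soLin_injective {n : ℕ} (g : SO n) : Function.Injective (soLin g) := by
  have h : soLin g⁻¹ ∘ₗ soLin g = LinearMap.id := by
    rw [← soLin_mul, inv_mul_cancel, soLin_one]
  exact Function.LeftInverse.injective (g := soLin g⁻¹) fun v => LinearMap.congr_fun h v

/-- The action `g • [v] = [g v]` of `SO(n)` on `ℝPⁿ`. -/
instance (n : ℕ) : MulAction (SO n) (RP n) where
  smul g x := Projectivization.map (soLin g) (soLin_injective g) x
  one_smul x := by
    change Projectivization.map (soLin (1 : SO n)) (soLin_injective 1) x = x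
    simp only [soLin_one]
    exact congrFun Projectivization.map_id x
  mul_smul g h x := by
    change Projectivization.map (soLin (g * h)) (soLin_injective (g * h)) x =
      Projectivization.map (soLin g) (soLin_injective g)
        (Projectivization.map (soLin h) (soLin_injective h) x)
    have hc : Function.Injective (soLin g ∘ₗ soLin h) := (soLin_injective g).comp (soLin_injective h)
    have := congrFun (Projectivization.map_comp (soLin h) (soLin_injective h) (soLin g)
      (soLin_injective g) hc) x
    simp only [soLin_mul]
    exact this

/-- The `ℝPⁿ`-associate of a principal `SO(n)`-bundle with total space `P`. -/
abbrev RPAssoc (n : ℕ) (P : Type*) [MulAction (SO n) P] : Type _ := AssocBundle (SO n) (RP n) P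

/-- The projection `ℝPⁿ ×_{SO(n)} P → P / SO(n)`. -/
abbrev rpAssocProj (n : ℕ) (P : Type*) [MulAction (SO n) P] :
    RPAssoc n P → Quotient (MulAction.orbitRel (SO n) P) := assocProj (SO n) (RP n) P

end

/-! Upper bound. Given `r` lines in one fibre, choose a unit vector on each. Each of the `2 ^ r`
choices of signs gives a polygon through the signed vectors, and it projects to a path through the
lines unless two consecutive vectors are antipodal. The product of the numbers `1 + ⟨vᵢ, vᵢ₊₁⟩`
vanishes exactly in that case, so the paths weighted by these normalized products form a continuous
family of probability measures. Changing the chosen vectors only permutes the sign choices, and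
`SO(n)` acts by isometries, so the measure descends to the associated bundle (`RP.randomPath_eq`,
`RP.parametrizedDTC_le`). This gives `dTC_r ≤ 2 ^ r - 1`, and `r ≤ 2 * r - 2`.

Lower bound. By freeness a fibre is a copy of `ℝPⁿ`. Put `k = r - 1` and restrict to tuples whose
first entry is a base point. Over an open set with a section, lift the path from the base point to
the `a`-th remaining entry. The endpoint of the lift picks one of the two unit vectors on that line.
Comparing it with `v a` gives a locally constant `ℤ/2`-valued function on an open part of `(Sⁿ)ᵏ`,
odd in the `a`-th variable and even in the others (`RP.exists_isOdd_of_section`). If at most `n * k`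
open sets sufficed, they could be distributed so that each variable receives `n` such functions.

The coboundary of such a function represents the generator of `H¹(ℝPⁿ)` pulled back from the `a`-th
factor, and the product of all `n`-th powers of these generators is nonzero. At cochain level, the
cup product of the `n * k` coboundaries takes the value 1 on an explicit chain of arbitrarily small
tuples (`SphereProduct.chain_cup`), so some small tuple has no function constant on it
(`SphereProduct.exists_small_forall_ne`). By the Lebesgue number lemma every sufficiently small
tuple does have one, a contradiction. Hence `TC_r ≥ n * (r - 1)`, which exceeds the upper bound for
large `n`. -/

/-! ### Mod 2 cochains on ordered tuples -/

namespace ListCochain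

variable {V W : Type*}

/-- The coboundary of a mod 2 cochain on finite sequences. -/
def cobd : (List V → ZMod 2) → List V → ZMod 2
  -- The empty list is the simplex of dimension -1: the complex is augmented, and the coboundary of
  -- `φ` at `[a]` is `φ []`.
  | _, [] => 0
  | φ, a :: L => φ L + cobd (fun M => φ (a :: M)) L

theorem cobd_add (φ ψ : List V → ZMod 2) (L : List V) :
    cobd (fun M => φ M + ψ M) L = cobd φ L + cobd ψ L := by
  induction L generalizing φ ψ with
  | nil => simp [cobd]
  | cons a L ih => simp only [cobd, ih]; ring

theorem cobd_const_mul (c : ZMod 2) (φ : List V → ZMod 2) (L : List V) :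
    cobd (fun M => c * φ M) L = c * cobd φ L := by
  induction L generalizing φ with
  | nil => simp [cobd]
  | cons a L ih => simp only [cobd, ih]; ring

theorem cobd_map (f : V → W) (φ : List W → ZMod 2) (L : List V) :
    cobd (fun M => φ (M.map f)) L = cobd φ (L.map f) := by
  induction L generalizing φ with
  | nil => simp [cobd]
  | cons a L ih => simp only [cobd, List.map_cons, ih (fun M => φ (f a :: M))]

theorem cobd_zero (L : List V) : cobd (fun _ => 0) L = 0 := by
  induction L with
  | nil => rfl
  | cons a L ih => simp [cobd, ih]

theorem cobd_sum {ι : Type*} (s : Finset ι) (φ : ι → List V → ZMod 2) (L : List V) :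
    cobd (fun M => ∑ i ∈ s, φ i M) L = ∑ i ∈ s, cobd (φ i) L := by
  classical
  induction s using Finset.induction_on with
  | empty => simp [cobd_zero]
  | insert a s ha ih => simp only [Finset.sum_insert ha, cobd_add, ih]

/-- The prism operator between two maps. -/
def prism (f g : V → W) : (List W → ZMod 2) → List V → ZMod 2
  | _, [] => 0
  | φ, a :: L => φ (f a :: g a :: L.map g) + prism f g (fun M => φ (f a :: M)) L

theorem prism_add (f g : V → W) (φ ψ : List W → ZMod 2) (L : List V) :
    prism f g (fun M => φ M + ψ M) L = prism f g φ L + prism f g ψ L := by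
  induction L generalizing φ ψ with
  | nil => simp [prism]
  | cons a L ih => simp only [prism, ih]; ring

/-- Locality of the prism: only tuples with entries `f a` or `g a`, `a ∈ L`, are met. This is what
lets diameters be tracked later. -/
theorem prism_congr (f g : V → W) (φ ψ : List W → ZMod 2) (L : List V)
    (h : ∀ M, (∀ x ∈ M, ∃ a ∈ L, x = f a ∨ x = g a) → φ M = ψ M) :
    prism f g φ L = prism f g ψ L := by
  induction L generalizing φ ψ with
  | nil => rfl
  | cons a L ih =>
    simp only [prism]
    rw [h, ih]
    · intro M hM
      apply h
      intro x hx
      rcases List.mem_cons.1 hx with rfl | hx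
      · exact ⟨a, by simp⟩
      · obtain ⟨b, hb, hb'⟩ := hM x hx
        exact ⟨b, by simp [hb], hb'⟩
    · intro x hx
      simp only [List.mem_cons, List.mem_map] at hx
      rcases hx with rfl | rfl | ⟨b, hb, rfl⟩
      · exact ⟨a, by simp⟩
      · exact ⟨a, by simp⟩
      · exact ⟨b, by simp [hb]⟩

/-- The chain homotopy identity between the pullbacks along `f` and `g`; signs disappear mod 2, and
the interior faces occur twice. -/
theorem cobd_prism (f g : V → W) (φ : List W → ZMod 2) (L : List V) :
    cobd (prism f g φ) L + prism f g (cobd φ) L = φ (L.map f) + φ (L.map g) := by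
  induction L generalizing φ with
  | nil => simp only [cobd, prism, List.map_nil, CharTwo.add_self_eq_zero]
  | cons a L ih =>
    have h1 := ih (fun M => φ (f a :: M))
    simp only [cobd, prism, List.map_cons, cobd_add, prism_add,
      cobd_map g (fun M => φ (f a :: g a :: M))] at h1 ⊢
    linear_combination h1 + CharTwo.add_self_eq_zero (prism f g φ L)
      + CharTwo.add_self_eq_zero (cobd (fun M => φ (f a :: g a :: M)) (L.map g))
      + CharTwo.add_self_eq_zero (φ (f a :: L.map g))

/-- The cup product of the coboundaries of the functions in `S`. -/
def cup : List (V → ZMod 2) → List V → ZMod 2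
  -- The unit 0-cochain. In general `cup S` is supported on lists of length `S.length + 1`.
  | [], [_] => 1
  | s :: S, a :: b :: L => (s a + s b) * cup S (b :: L)
  | _, _ => 0

/-- The cup product of `s` with the coboundaries of the functions in `S`. -/
def cupPrim (s : V → ZMod 2) (S : List (V → ZMod 2)) : List V → ZMod 2
  | [] => 0
  | a :: L => s a * cup S (a :: L)

theorem cup_nil (S : List (V → ZMod 2)) : cup S [] = 0 := by cases S <;> rfl

theorem cobd_cup (S : List (V → ZMod 2)) (L : List V) : cobd (cup S) L = 0 := by
  induction S generalizing L with
  | nil =>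
    match L with
    | [] => rfl
    | [a] => rfl
    | [a, b] => rfl
    | a :: b :: c :: L =>
      simp [cobd, cup, cobd_zero]
  | cons s S ih =>
    match L with
    | [] => rfl
    | [a] => rfl
    | [a, b] => simp [cobd, cup]
    | a :: b :: c :: L =>
      have h := ih (b :: c :: L)
      simp only [cobd, cup, cobd_const_mul] at h ⊢
      linear_combination (s a + s b) * h + CharTwo.add_self_eq_zero (s c * cup S (c :: L))

/-- Leibniz rule: the remaining factors form a cocycle by `cobd_cup`, so only the coboundary of `s`
contributes. -/
theorem cobd_cupPrim (s : V → ZMod 2) (S : List (V → ZMod 2)) (L : List V) :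
    cobd (cupPrim s S) L = cup (s :: S) L := by
  match L with
  | [] => rfl
  | [a] => rfl
  | a :: b :: L =>
    have h := cobd_cup S (a :: b :: L)
    simp only [cobd, cup, cupPrim, cobd_const_mul] at h ⊢
    linear_combination s a * h - CharTwo.add_self_eq_zero (s a * cup S (b :: L))

theorem exists_ne_of_cup_ne_zero (S : List (V → ZMod 2)) (L : List V) (h : cup S L ≠ 0)
    (s : V → ZMod 2) (hs : s ∈ S) : ∃ a ∈ L, ∃ b ∈ L, s a ≠ s b := by
  induction S generalizing L with
  | nil => simp at hs
  | cons s' S ih =>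
    match L with
    | [] => exact absurd rfl h
    | [a] => exact absurd rfl h
    | a :: b :: L =>
      simp only [cup] at h
      rcases List.mem_cons.1 hs with rfl | hs
      · refine ⟨a, by simp, b, by simp, fun e => h ?_⟩
        rw [e, CharTwo.add_self_eq_zero, zero_mul]
      · obtain ⟨x, hx, y, hy, hxy⟩ := ih (b :: L) (right_ne_zero_of_mul h) hs
        exact ⟨x, by simp only [List.mem_cons] at hx ⊢; tauto,
          y, by simp only [List.mem_cons] at hy ⊢; tauto, hxy⟩

/-- The cup product sees only differences of values, so it is invariant under maps that shift each
function by a constant. Antipodal maps do this to odd and even functions. -/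
theorem cup_map (T : V → V) (S : List (V → ZMod 2)) (L : List V)
    (h : ∀ s ∈ S, ∀ a ∈ L, ∀ b ∈ L, s (T a) + s (T b) = s a + s b) :
    cup S (L.map T) = cup S L := by
  induction S generalizing L with
  | nil =>
    match L with
    | [] => rfl
    | [a] => rfl
    | a :: b :: L => rfl
  | cons s S ih =>
    match L with
    | [] => rfl
    | [a] => rfl
    | a :: b :: L =>
      have := ih (b :: L) fun s hs x hx y hy => h s (by simp [hs]) x (List.mem_cons_of_mem _ hx) y
        (List.mem_cons_of_mem _ hy)
      simp only [List.map_cons, cup] at this ⊢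
      rw [this, h s (by simp) a (by simp) b (by simp)]

end ListCochain

/-! ### A Borsuk--Ulam theorem for products of spheres -/

namespace SphereProduct

open ListCochain

/-- Families of `k` vectors in `ℝⁿ⁺¹`. -/
abbrev Vecs (k n : ℕ) : Type := Fin k → Fin (n + 1) → ℝ

variable {k n : ℕ}

/-- The product of `k` copies of the unit sphere of the `ℓ¹` norm. -/
def spheres (k n : ℕ) : Set (Vecs k n) := {v | ∀ j, ∑ m, |v j m| = 1}

/-- The product of the closed hemispheres of dimensions `J j`. -/
def hemis (J : Fin k → ℕ) : Set (Vecs k n) :=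
  {v | ∀ j, ∑ m, |v j m| = 1 ∧ (∀ m : Fin (n + 1), J j < m → v j m = 0) ∧
    ∀ m : Fin (n + 1), (m : ℕ) = J j → 0 ≤ v j m}

/-- The product of the poles of the hemispheres of dimensions `J j`. -/
def pole (J : Fin k → ℕ) : Vecs k n := fun j m => if (m : ℕ) = J j then 1 else 0

/-- The `j`-th antipodal map. -/
def antipode (j : Fin k) (v : Vecs k n) : Vecs k n := Function.update v j (-v j)

/-- The straight line homotopy to the pole. -/
noncomputable def contr (J : Fin k → ℕ) (t : ℝ) (v : Vecs k n) : Vecs k n :=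
  fun j m => (1 - t) * v j m + t * pole J j m

theorem antipode_self (j : Fin k) (v : Vecs k n) : antipode j v j = -v j := by simp [antipode]

theorem antipode_ne {i j : Fin k} (h : i ≠ j) (v : Vecs k n) : antipode j v i = v i := by
  simp [antipode, h]

theorem antipode_antipode (j : Fin k) (v : Vecs k n) : antipode j (antipode j v) = v := by
  ext i m
  by_cases h : i = j
  · subst h; simp [antipode_self]
  · simp [antipode_ne h]

theorem antipode_comm (i j : Fin k) (v : Vecs k n) : antipode i (antipode j v) = antipode j (antipode i v) := by
  ext l m
  by_cases hi : l = i <;> by_cases hj : l = j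
  · subst hi; subst hj; rfl
  · subst hi; simp [antipode_self, antipode_ne hj]
  · subst hj; simp [antipode_self, antipode_ne hi]
  · simp [antipode_ne hi, antipode_ne hj]

theorem hemis_subset_spheres (J : Fin k → ℕ) : hemis J ⊆ spheres k n := fun _ h j => (h j).1

theorem contr_zero (J : Fin k → ℕ) : contr (n := n) J 0 = id := by
  ext v j m; simp [contr]

theorem contr_one (J : Fin k → ℕ) : contr (n := n) J 1 = fun _ => pole J := by
  ext v j m; simp [contr]

theorem pole_eq_single (J : Fin k → ℕ) (j : Fin k) (h : J j ≤ n) :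
    (pole J j : Fin (n + 1) → ℝ) = Pi.single ⟨J j, by omega⟩ 1 := by
  ext m
  simp only [pole, Pi.single_apply, Fin.ext_iff]

theorem pole_mem_hemis (J : Fin k → ℕ) (hI : ∀ j, J j ≤ n) : (pole J : Vecs k n) ∈ hemis J := by
  intro j
  refine ⟨?_, fun m hm => by simp [pole, hm.ne'], fun m hm => by simp [pole, hm]⟩
  rw [pole_eq_single J j (hI j)]
  simp [Pi.single_apply, apply_ite abs]

theorem abs_le_one_of_mem_spheres {v : Vecs k n} (h : v ∈ spheres k n) (j m) : |v j m| ≤ 1 := by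
  rw [← h j]
  exact Finset.single_le_sum (f := fun m => |v j m|) (fun _ _ => abs_nonneg _) (Finset.mem_univ m)

/-- The reason for the `ℓ¹` norm: on the hemisphere the top coordinate is nonnegative, so the norm
is affine along the segment to the pole and no renormalization is needed. -/
theorem contr_mem_hemis (J : Fin k → ℕ) (hI : ∀ j, J j ≤ n) {v : Vecs k n} (hv : v ∈ hemis J)
    {t : ℝ} (h0 : 0 ≤ t) (h1 : t ≤ 1) : contr J t v ∈ hemis J := by
  intro j
  obtain ⟨a, b, c⟩ := hv j
  have h1' : 0 ≤ 1 - t := by linarith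
  have hp := pole_mem_hemis (n := n) J hI j
  refine ⟨?_, fun m hm => by simp [contr, b m hm, hp.2.1 m hm], fun m hm => ?_⟩
  · have : ∀ m, |contr J t v j m| = (1 - t) * |v j m| + t * |pole J j m| := by
      intro m
      by_cases hm : (m : ℕ) = J j
      · have := c m hm
        simp only [contr, pole, hm, if_true]
        rw [abs_of_nonneg (by positivity), abs_of_nonneg this]
        simp
      · simp [contr, pole, hm, abs_mul, abs_of_nonneg h1']
    simp only [this, Finset.sum_add_distrib, ← Finset.mul_sum, a, hp.1]
    ring
  · have := c m hm
    have := hp.2.2 m hm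
    simp only [contr]
    positivity

theorem dist_contr_le (J : Fin k → ℕ) {v w : Vecs k n} (hw : w ∈ spheres k n)
    {t t' : ℝ} (h0 : 0 ≤ t) (h1 : t ≤ 1) :
    dist (contr J t v) (contr J t' w) ≤ dist v w + 2 * |t - t'| := by
  rw [dist_pi_le_iff (by positivity)]
  intro j
  rw [dist_pi_le_iff (by positivity)]
  intro m
  have e1 : |v j m - w j m| ≤ dist v w :=
    ((dist_le_pi_dist (v j) (w j) m)).trans (dist_le_pi_dist v w j)
  have e2 := abs_le_one_of_mem_spheres hw j m
  have e3 : |(pole J j m : ℝ)| ≤ 1 := by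
    simp only [pole]; split_ifs <;> simp
  have e4 : |1 - t| ≤ 1 := by rw [abs_of_nonneg (by linarith)]; linarith
  have e5 : contr J t v j m - contr J t' w j m =
      (1 - t) * (v j m - w j m) + (t - t') * (pole J j m - w j m) := by
    simp only [contr]; ring
  rw [Real.dist_eq, e5]
  refine (abs_add_le _ _).trans (add_le_add ?_ ?_)
  · rw [abs_mul]
    calc _ ≤ 1 * |v j m - w j m| := by gcongr
      _ ≤ _ := by linarith
  · rw [abs_mul, mul_comm]
    gcongr
    exact (abs_sub _ _).trans (by linarith)

theorem dist_antipode_antipode (j : Fin k) (v w : Vecs k n) : dist (antipode j v) (antipode j w) = dist v w := by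
  have key : ∀ v w : Vecs k n, dist (antipode j v) (antipode j w) ≤ dist v w := by
    intro v w
    rw [dist_pi_le_iff dist_nonneg]
    intro i
    by_cases h : i = j
    · subst h; rw [antipode_self, antipode_self, dist_neg_neg]; exact dist_le_pi_dist v w i
    · rw [antipode_ne h, antipode_ne h]; exact dist_le_pi_dist v w i
  refine le_antisymm (key v w) ?_
  simpa [antipode_antipode] using key (antipode j v) (antipode j w)

/-- The multi-index `J` with its `j`-th entry lowered by one. -/
def lower (J : Fin k → ℕ) (j : Fin k) : Fin k → ℕ := Function.update J j (J j - 1)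

theorem lower_self (J : Fin k → ℕ) (j : Fin k) : lower J j j = J j - 1 := by simp [lower]

theorem lower_ne (J : Fin k → ℕ) {i j : Fin k} (h : i ≠ j) : lower J j i = J i := by
  simp [lower, h]

theorem lower_comm (J : Fin k → ℕ) (i j : Fin k) : lower (lower J j) i = lower (lower J i) j := by
  ext l
  by_cases hi : l = i <;> by_cases hj : l = j
  · subst hi; subst hj; rfl
  · subst hi; simp [lower_self, lower_ne _ hj]
  · subst hj; simp [lower_self, lower_ne _ hi]
  · simp [lower_ne _ hi, lower_ne _ hj]

theorem sum_lower (J : Fin k → ℕ) (j : Fin k) (h : J j ≠ 0) :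
    ∑ i, lower J j i + 1 = ∑ i, J i := by
  simp only [lower]
  rw [Finset.sum_update_of_mem (Finset.mem_univ j),
    ← Finset.add_sum_erase _ J (Finset.mem_univ j), Finset.sdiff_singleton_eq_erase]
  omega

theorem lower_le {J : Fin k → ℕ} (hI : ∀ j, J j ≤ n) (j i : Fin k) : lower J j i ≤ n := by
  by_cases h : i = j
  · subst h; rw [lower_self]; have := hI i; omega
  · rw [lower_ne _ h]; exact hI i

/-- The hemisphere one dimension lower lies in the equator; with its antipode it makes up the
boundary sphere. -/
theorem mem_hemis_of_lower {J : Fin k → ℕ} {j : Fin k} (h : J j ≠ 0) {v : Vecs k n}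
    (hv : v ∈ hemis (lower J j)) : v ∈ hemis J ∧ antipode j v ∈ hemis J := by
  have hz : ∀ m : Fin (n + 1), J j ≤ m → v j m = 0 := fun m hm =>
    (hv j).2.1 m (by rw [lower_self]; omega)
  constructor <;> intro i <;> by_cases hi : i = j
  · subst hi
    exact ⟨(hv i).1, fun m hm => hz m hm.le, fun m hm => (hz m hm.ge).ge⟩
  · have := hv i
    rwa [lower_ne _ hi] at this
  · subst hi
    rw [antipode_self]
    refine ⟨by simpa using (hv i).1, fun m hm => ?_, fun m hm => ?_⟩
    · simp [hz m hm.le]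
    · simp [hz m hm.ge]
  · have := hv i
    rw [lower_ne _ hi] at this
    rwa [antipode_ne hi]

/-! ### An explicit chain in a product of hemispheres, and its boundary. -/

/-- The cochain `(1 + Tⱼ) φ`. -/
def symm (j : Fin k) (φ : List (Vecs k n) → ZMod 2) (L : List (Vecs k n)) : ZMod 2 :=
  φ L + φ (L.map (antipode j))

/-- The contracting homotopy of cochains induced by `contr J`, subdivided into `M` steps. -/
noncomputable def contrCochain (M : ℕ) (J : Fin k → ℕ) (φ : List (Vecs k n) → ZMod 2)
    (L : List (Vecs k n)) : ZMod 2 :=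
  (∑ t ∈ Finset.range M, prism (contr J ((t : ℝ) / M)) (contr J (((t + 1 : ℕ) : ℝ) / M)) φ L) +
    φ (pole J :: L.map fun _ => pole J)

/-- The prisms telescope from the identity to the constant map at the pole, and the last term of
`contrCochain`, a cone with apex the pole, contracts that constant map in the augmented complex. -/
theorem cobd_contrCochain {M : ℕ} (hM : M ≠ 0) (J : Fin k → ℕ) (φ : List (Vecs k n) → ZMod 2)
    (L : List (Vecs k n)) :
    cobd (contrCochain M J φ) L + contrCochain M J (cobd φ) L = φ L := by
  have hM' : (M : ℝ) ≠ 0 := by exact_mod_cast hM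
  have e : contrCochain M J φ = fun L => (∑ t ∈ Finset.range M,
      prism (contr J ((t : ℝ) / M)) (contr J (((t + 1 : ℕ) : ℝ) / M)) φ L) +
      (fun N => φ (pole J :: N)) (L.map fun _ => pole J) := rfl
  have hsum : ∑ t ∈ Finset.range M, (φ (L.map (contr J ((t : ℝ) / M))) +
      φ (L.map (contr J (((t + 1 : ℕ) : ℝ) / M)))) = φ L + φ (L.map fun _ => pole J) := by
    have h := Finset.sum_range_sub (fun t : ℕ => φ (L.map (contr J ((t : ℝ) / M)))) M
    simp only [CharP.cast_eq_zero, zero_div, contr_zero, div_self hM', contr_one, List.map_id,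
      CharTwo.sub_eq_add] at h
    rw [add_comm (φ L), ← h]
    exact Finset.sum_congr rfl fun _ _ => add_comm _ _
  have h1 : ∑ t ∈ Finset.range M,
      (cobd (prism (contr J ((t : ℝ) / M)) (contr J (((t + 1 : ℕ) : ℝ) / M)) φ) L +
        prism (contr J ((t : ℝ) / M)) (contr J (((t + 1 : ℕ) : ℝ) / M)) (cobd φ) L) =
      φ L + φ (L.map fun _ => pole J) := by
    simp only [cobd_prism, hsum]
  rw [Finset.sum_add_distrib] at h1
  rw [e, cobd_add, cobd_sum, cobd_map (fun _ => pole J) (fun N => φ (pole J :: N))]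
  simp only [contrCochain, cobd]
  linear_combination h1 + CharTwo.add_self_eq_zero (φ (L.map fun _ => pole J))
    + CharTwo.add_self_eq_zero (cobd (fun N => φ (pole J :: N)) (L.map fun _ => pole J))

theorem contrCochain_add (M : ℕ) (J : Fin k → ℕ) (φ ψ : List (Vecs k n) → ZMod 2)
    (L : List (Vecs k n)) :
    contrCochain M J (fun N => φ N + ψ N) L = contrCochain M J φ L + contrCochain M J ψ L := by
  simp only [contrCochain, prism_add, Finset.sum_add_distrib]
  ring

theorem symm_add (j : Fin k) (φ ψ : List (Vecs k n) → ZMod 2) (L : List (Vecs k n)) :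
    symm j (fun N => φ N + ψ N) L = symm j φ L + symm j ψ L := by
  simp only [symm]; ring

theorem symm_comm (i j : Fin k) (φ : List (Vecs k n) → ZMod 2) :
    symm i (symm j φ) = symm j (symm i φ) := by
  ext L
  have : (antipode j : Vecs k n → Vecs k n) ∘ antipode i = antipode i ∘ antipode j := by
    ext1 v; exact antipode_comm j i v
  simp only [symm, List.map_map, this]
  ring

theorem symm_symm_self (j : Fin k) (φ : List (Vecs k n) → ZMod 2) :
    symm j (symm j φ) = fun _ => 0 := by
  ext L
  have : (antipode j : Vecs k n → Vecs k n) ∘ antipode j = id := by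
    ext1 v; exact antipode_antipode j v
  simp only [symm, List.map_map, this, List.map_id]
  rw [add_comm (φ (L.map _)) (φ L), CharTwo.add_self_eq_zero]

theorem cobd_symm (j : Fin k) (φ : List (Vecs k n) → ZMod 2) :
    cobd (symm j φ) = symm j (cobd φ) := by
  ext L
  have : symm j φ = fun L => φ L + φ (L.map (antipode j)) := rfl
  rw [this, cobd_add, cobd_map]
  rfl

/-- Evaluation on a `q`-dimensional chain in the product of hemispheres of dimensions `J j`,
where `q = ∑ j, J j`. -/
noncomputable def chain (M : ℕ) : ℕ → (Fin k → ℕ) → (List (Vecs k n) → ZMod 2) → ZMod 2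
  | 0, J, φ => φ [pole J]
  -- Dually, the chain for `J` is the contraction applied to the sum over `j` of `(1 + Tⱼ)` times
  -- the chain for `lower J j`. A factor of dimension 0 has no boundary and is skipped.
  | q + 1, J, φ => ∑ j, if J j = 0 then 0 else
      chain M q (lower J j) (symm j (contrCochain M J φ))

theorem chain_add (M q : ℕ) (J : Fin k → ℕ) (φ ψ : List (Vecs k n) → ZMod 2) :
    chain M q J (fun L => φ L + ψ L) = chain M q J φ + chain M q J ψ := by
  induction q generalizing J φ ψ with
  | zero => rfl
  | succ q ih =>
    simp only [chain, ← Finset.sum_add_distrib]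
    refine Finset.sum_congr rfl fun j _ => ?_
    split_ifs
    · simp
    · rw [← ih]
      congr 1
      ext L
      rw [← symm_add]
      congr 1
      ext N
      rw [contrCochain_add]

theorem chain_zero (M q : ℕ) (J : Fin k → ℕ) :
    chain M q J (fun _ : List (Vecs k n) => 0) = 0 := by
  have h := chain_add M q J (fun _ : List (Vecs k n) => 0) (fun _ => 0)
  simpa using h

/-- Stokes' formula. By the homotopy identity the contraction of `cobd φ` is `φ` plus a coboundary;
by induction the coboundary terms form a double sum, which vanishes because the prescribed boundary
is a cycle. -/
theorem chain_cobd {M : ℕ} (hM : M ≠ 0) (q : ℕ) (J : Fin k → ℕ) (hI : ∑ j, J j = q + 1)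
    (φ : List (Vecs k n) → ZMod 2) :
    chain M (q + 1) J (cobd φ) = ∑ j, if J j = 0 then 0 else chain M q (lower J j) (symm j φ) := by
  induction q generalizing J φ with
  | zero =>
    rw [chain]
    refine Finset.sum_congr rfl fun j _ => ?_
    split_ifs
    · rfl
    · simp only [chain]
      have : contrCochain M J (cobd φ) = fun L => φ L + cobd (contrCochain M J φ) L := by
        ext L
        rw [← cobd_contrCochain hM J φ L]
        linear_combination -CharTwo.add_self_eq_zero (cobd (contrCochain M J φ) L)
      rw [this, symm_add]
      simp [symm, cobd, CharTwo.add_self_eq_zero]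
  | succ q ih =>
    have key : contrCochain M J (cobd φ) = fun L => φ L + cobd (contrCochain M J φ) L := by
      ext L
      rw [← cobd_contrCochain hM J φ L]
      linear_combination -CharTwo.add_self_eq_zero (cobd (contrCochain M J φ) L)
    have key' : ∀ j, symm j (contrCochain M J (cobd φ)) = fun L => symm j φ L +
        cobd (symm j (contrCochain M J φ)) L := by
      intro j
      ext L
      rw [key, symm_add, cobd_symm]
    have hzero : ∑ j, (if J j = 0 then 0 else
        chain M (q + 1) (lower J j) (cobd (symm j (contrCochain M J φ)))) = 0 := by
      have : ∀ j, (if J j = 0 then 0 else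
          chain M (q + 1) (lower J j) (cobd (symm j (contrCochain M J φ)))) =
          ∑ i, if J j = 0 ∨ lower J j i = 0 then 0 else
            chain M q (lower (lower J j) i) (symm i (symm j (contrCochain M J φ))) := by
        intro j
        by_cases hj : J j = 0
        · simp [hj]
        · rw [if_neg hj, ih _ (by have := sum_lower J j hj; omega)]
          simp [hj]
      simp only [this]
      rw [← Fintype.sum_prod_type']
      -- The terms `(i, j)` and `(j, i)` cancel, and the diagonal ones vanish since `(1 + Tⱼ)² = 0`
      -- mod 2.
      refine Finset.sum_involution (fun x _ => (x.2, x.1)) ?_ ?_ (by simp) (by simp)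
      · rintro ⟨j, i⟩ -
        have hc : (J j = 0 ∨ lower J j i = 0) ↔ (J i = 0 ∨ lower J i j = 0) := by
          by_cases h : i = j
          · subst h; rfl
          · rw [lower_ne _ h, lower_ne _ (Ne.symm h), or_comm]
        simp only [hc, lower_comm J i j, symm_comm i j]
        exact CharTwo.add_self_eq_zero _
      · rintro ⟨j, i⟩ - h e
        obtain rfl : i = j := by simpa using congrArg Prod.fst e
        apply h
        simp only [symm_symm_self, chain_zero, ite_self]
    rw [chain]
    calc _ = ∑ j, ((if J j = 0 then 0 else chain M (q + 1) (lower J j) (symm j φ)) +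
          (if J j = 0 then 0 else
            chain M (q + 1) (lower J j) (cobd (symm j (contrCochain M J φ))))) := by
          refine Finset.sum_congr rfl fun j _ => ?_
          split_ifs
          · simp
          · rw [key', chain_add]
      _ = _ := by rw [Finset.sum_add_distrib, hzero, add_zero]

/-! ### Size of the tuples on which the chain evaluates. -/

/-- A finite sequence of points of `D` with mutual distances at most `δ`. -/
def IsSmall (δ : ℝ) (D : Set (Vecs k n)) (L : List (Vecs k n)) : Prop :=
  (∀ v ∈ L, v ∈ D) ∧ ∀ v ∈ L, ∀ w ∈ L, dist v w ≤ δ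

theorem contrCochain_congr {M : ℕ} (hM : M ≠ 0) {δ : ℝ} (hδ : 2 / M ≤ δ) (J : Fin k → ℕ)
    (hI : ∀ j, J j ≤ n) {ε : ℝ} (φ ψ : List (Vecs k n) → ZMod 2)
    (h : ∀ L, IsSmall (ε + δ) (hemis J) L → φ L = ψ L) (hε : 0 ≤ ε) (L : List (Vecs k n))
    (hL : IsSmall ε (hemis J) L) : contrCochain M J φ L = contrCochain M J ψ L := by
  have hM' : (0 : ℝ) < M := by positivity
  have hδ0 : 0 ≤ δ := le_trans (by positivity) hδ
  unfold contrCochain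
  congr 1
  · refine Finset.sum_congr rfl fun t ht => prism_congr _ _ _ _ _ fun N hN => h N ?_
    have ht' : ((t + 1 : ℕ) : ℝ) ≤ M := by exact_mod_cast Finset.mem_range.1 ht
    set a : ℝ := (t : ℝ) / M with ha
    set b : ℝ := ((t + 1 : ℕ) : ℝ) / M with hb
    have hab : b - a = 1 / M := by
      rw [ha, hb]; push_cast; ring
    have ha0 : 0 ≤ a := by positivity
    have hb0 : 0 ≤ b := by positivity
    have hb1 : b ≤ 1 := (div_le_one hM').2 ht'
    have hM1 : 0 < 1 / (M : ℝ) := by positivity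
    have ha1 : a ≤ 1 := by linarith
    have hd : 2 * (1 / (M : ℝ)) ≤ δ := by rw [← mul_div_assoc, mul_one]; exact hδ
    constructor
    · intro v hv
      obtain ⟨w, hw, rfl | rfl⟩ := hN v hv
      · exact contr_mem_hemis J hI (hL.1 w hw) ha0 ha1
      · exact contr_mem_hemis J hI (hL.1 w hw) hb0 hb1
    · have key : ∀ x ∈ L, ∀ y ∈ L, ∀ t t' : ℝ, 0 ≤ t → t ≤ 1 → |t - t'| ≤ 1 / M →
          dist (contr J t x) (contr J t' y) ≤ ε + δ := by
        intro x hx y hy t t' h0 h1 hh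
        have := dist_contr_le (t' := t') (v := x) J (hemis_subset_spheres J (hL.1 y hy)) h0 h1
        have := hL.2 x hx y hy
        linarith
      intro v hv w hw
      obtain ⟨x, hx, rfl | rfl⟩ := hN v hv <;> obtain ⟨y, hy, rfl | rfl⟩ := hN w hw
      · exact key x hx y hy _ _ ha0 ha1 (by simp)
      · exact key x hx y hy _ _ ha0 ha1 (by rw [abs_sub_comm, hab, abs_of_pos hM1])
      · exact key x hx y hy _ _ hb0 hb1 (by rw [hab, abs_of_pos hM1])
      · exact key x hx y hy _ _ hb0 hb1 (by simp)
  · have hp : ∀ v ∈ pole J :: L.map (fun _ => (pole J : Vecs k n)), v = pole J := by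
      intro v hv
      simp only [List.mem_cons, List.mem_map] at hv
      rcases hv with rfl | ⟨_, _, rfl⟩ <;> rfl
    refine h _ ⟨fun v hv => ?_, fun v hv w hw => ?_⟩
    · rw [hp v hv]; exact pole_mem_hemis J hI
    · rw [hp v hv, hp w hw, dist_self]; positivity

/-- Each of the `q` contractions enlarges the diameter by at most `2 / M`, and the antipodal maps
are isometries. -/
theorem chain_congr {M : ℕ} (hM : M ≠ 0) {δ : ℝ} (hδ : 2 / M ≤ δ) (q : ℕ) (J : Fin k → ℕ)
    (hI : ∀ j, J j ≤ n) (φ ψ : List (Vecs k n) → ZMod 2)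
    (h : ∀ L, IsSmall (q * δ) (hemis J) L → φ L = ψ L) : chain M q J φ = chain M q J ψ := by
  have hδ0 : 0 ≤ δ := le_trans (by positivity) hδ
  induction q generalizing J φ ψ with
  | zero =>
    refine h _ ⟨fun v hv => ?_, fun v hv w hw => ?_⟩
    · rw [List.mem_singleton.1 hv]; exact pole_mem_hemis J hI
    · rw [List.mem_singleton.1 hv, List.mem_singleton.1 hw]; simp
  | succ q ih =>
    simp only [chain]
    refine Finset.sum_congr rfl fun j _ => ?_
    split_ifs with hj
    · rfl
    refine ih _ (lower_le hI j) _ _ fun L hL => ?_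
    have hc : ∀ N, IsSmall (q * δ) (hemis J) N → contrCochain M J φ N = contrCochain M J ψ N := by
      refine fun N hN => contrCochain_congr hM hδ J hI φ ψ (fun L hL => h L ?_) (by positivity) N hN
      push_cast
      rwa [add_mul, one_mul]
    unfold symm
    congr 1
    · exact hc _ ⟨fun v hv => (mem_hemis_of_lower hj (hL.1 v hv)).1, hL.2⟩
    · refine hc _ ⟨fun v hv => ?_, fun v hv w hw => ?_⟩
      · obtain ⟨v', hv', rfl⟩ := List.mem_map.1 hv
        exact (mem_hemis_of_lower hj (hL.1 v' hv')).2
      · obtain ⟨v', hv', rfl⟩ := List.mem_map.1 hv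
        obtain ⟨w', hw', rfl⟩ := List.mem_map.1 hw
        rw [dist_antipode_antipode]
        exact hL.2 v' hv' w' hw'

/-- `s` is odd in the `j`-th variable and even in the others. -/
def IsOdd (j : Fin k) (s : Vecs k n → ZMod 2) : Prop :=
  ∀ v ∈ spheres k n, s (antipode j v) = s v + 1 ∧ ∀ i, i ≠ j → s (antipode i v) = s v

/-- Apply Stokes to the primitive `s ∪ R`, where `s` is odd in variable `i` and `R` is the product
of the other coboundaries, invariant under all antipodes. Then `(1 + Tᵢ)(s ∪ R) = R`, while `(1 +
Tⱼ)(s ∪ R) = 0` for `j ≠ i`. Each factor removed lowers one dimension, down to the unit evaluated at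
a point. -/
theorem chain_cup {M : ℕ} (hM : M ≠ 0) (S : List (Fin k × (Vecs k n → ZMod 2)))
    (hS : ∀ p ∈ S, IsOdd p.1 p.2) (hn : ∀ j, (S.map Prod.fst).count j ≤ n) :
    chain M S.length (fun j => (S.map Prod.fst).count j) (cup (S.map Prod.snd)) = 1 := by
  induction S with
  | nil => simp [chain, cup]
  | cons p S ih =>
    obtain ⟨i, s⟩ := p
    set J : Fin k → ℕ := fun j => (((i, s) :: S).map Prod.fst).count j with hIdef
    have hIi : J i ≠ 0 := by simp [hIdef]
    have hlow : lower J i = fun j => (S.map Prod.fst).count j := by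
      ext j
      by_cases hj : j = i
      · subst hj; simp [lower_self, hIdef]
      · rw [lower_ne _ hj]; simp [hIdef, Ne.symm hj]
    have hsum : ∀ T : List (Fin k × (Vecs k n → ZMod 2)),
        ∑ j, (T.map Prod.fst).count j = T.length := by
      intro T
      induction T with
      | nil => simp
      | cons a T ih =>
        simp only [List.map_cons, List.count_cons, Finset.sum_add_distrib, ih, List.length_cons]
        simp
    have hδ : (2 : ℝ) / M ≤ 2 / M := le_rfl
    have hs : IsOdd i s := hS (i, s) (by simp)
    have hmem : ∀ {J : Fin k → ℕ} {c : ℝ} {L : List (Vecs k n)}, IsSmall c (hemis J) L →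
        ∀ v ∈ L, v ∈ spheres k n := fun hL v hv => hemis_subset_spheres _ (hL.1 v hv)
    have hcup : ∀ (j : Fin k) (L : List (Vecs k n)), (∀ v ∈ L, v ∈ spheres k n) →
        cup (S.map Prod.snd) (L.map (antipode j)) = cup (S.map Prod.snd) L := by
      intro j L hL
      refine cup_map _ _ _ fun s' hs' a ha b hb => ?_
      obtain ⟨⟨j', s'⟩, hp, rfl⟩ := List.mem_map.1 hs'
      have ho := hS _ (List.mem_cons_of_mem _ hp)
      by_cases hj : j = j'
      · subst hj
        rw [(ho a (hL a ha)).1, (ho b (hL b hb)).1]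
        linear_combination CharTwo.add_self_eq_zero (1 : ZMod 2)
      · rw [(ho a (hL a ha)).2 j hj, (ho b (hL b hb)).2 j hj]
    have e : cup (((i, s) :: S).map Prod.snd) = cobd (cupPrim s (S.map Prod.snd)) := by
      ext L; rw [cobd_cupPrim]; rfl
    rw [e, List.length_cons, chain_cobd hM _ _ (by rw [hsum]; rfl), Finset.sum_eq_single i]
    · rw [if_neg hIi]
      have : chain M S.length (lower J i) (symm i (cupPrim s (S.map Prod.snd))) =
          chain M S.length (lower J i) (cup (S.map Prod.snd)) := by
        refine chain_congr hM hδ _ _ (lower_le hn i) _ _ fun L hL => ?_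
        match L with
        | [] => simp [symm, cupPrim, cup_nil]
        | a :: L =>
          have h1 := hcup i (a :: L) (hmem hL)
          rw [List.map_cons] at h1
          simp only [symm, cupPrim, List.map_cons]
          rw [h1, (hs a (hmem hL a (by simp))).1]
          linear_combination CharTwo.add_self_eq_zero (s a * cup (S.map Prod.snd) (a :: L))
      rw [this, hlow]
      refine ih (fun p hp => hS p (List.mem_cons_of_mem _ hp)) fun j => le_trans ?_ (hn j)
      exact List.count_le_count_cons
    · intro j _ hj
      split_ifs with h0
      · rfl
      rw [← chain_zero M S.length (lower J j)]
      refine chain_congr hM hδ _ _ (lower_le hn j) _ _ fun L hL => ?_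
      match L with
      | [] => simp [symm, cupPrim]
      | a :: L =>
        have h1 := hcup j (a :: L) (hmem hL)
        rw [List.map_cons] at h1
        simp only [symm, cupPrim, List.map_cons]
        rw [h1, (hs a (hmem hL a (by simp))).2 j hj, CharTwo.add_self_eq_zero]
    · simp

/-- Given, for each `j`, `n` functions with values in `ℤ/2` that are odd in the `j`-th variable and
even in the others, there is an arbitrarily small finite set of points of the product of spheres on
which none of these functions is constant. -/
theorem exists_small_forall_ne (s : Fin k → Fin n → Vecs k n → ZMod 2)
    (hs : ∀ j a, IsOdd j (s j a)) {ε : ℝ} (hε : 0 < ε) :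
    ∃ L : List (Vecs k n), IsSmall ε (spheres k n) L ∧ L ≠ [] ∧
      ∀ j a, ∃ v ∈ L, ∃ w ∈ L, s j a v ≠ s j a w := by
  classical
  set S : List (Fin k × (Vecs k n → ZMod 2)) :=
    (Finset.univ : Finset (Fin k × Fin n)).toList.map fun p => (p.1, s p.1 p.2) with hSdef
  have hcount : ∀ j, (S.map Prod.fst).count j = n := by
    intro j
    rw [hSdef, List.map_map, ← Multiset.coe_count, ← Multiset.map_coe, Finset.coe_toList,
      Multiset.count_map]
    have : Multiset.card (Multiset.filter (fun p : Fin k × Fin n => j = p.1)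
        (Finset.univ : Finset (Fin k × Fin n)).val) =
        (Finset.univ.filter fun p : Fin k × Fin n => j = p.1).card := rfl
    refine this.trans ?_
    have h2 : (Finset.univ.filter fun p : Fin k × Fin n => j = p.1) =
        Finset.univ.map ⟨fun a : Fin n => (j, a), Prod.mk_right_injective j⟩ := by
      ext ⟨i, a⟩
      simp [eq_comm]
    rw [h2]; simp
  -- With this `M` the accumulated diameter `S.length * (2 / M)` stays below `ε`.
  obtain ⟨M, hM⟩ := exists_nat_gt (2 * S.length / ε)
  have hM0 : M ≠ 0 := by
    rintro rfl
    have : 0 ≤ 2 * (S.length : ℝ) / ε := by positivity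
    simp at hM
    linarith
  have h1 := chain_cup hM0 S (fun p hp => by
    obtain ⟨⟨j, a⟩, -, rfl⟩ := List.mem_map.1 hp
    exact hs j a) fun j => (hcount j).le
  by_contra hcon
  push Not at hcon
  have h2 := chain_congr hM0 le_rfl S.length (fun j => (S.map Prod.fst).count j)
    (fun j => (hcount j).le) (cup (S.map Prod.snd)) (fun _ => 0) fun L hL => by
      by_contra hne
      have hMpos : (0 : ℝ) < M := by positivity
      have hsm : IsSmall ε (spheres k n) L := by
        refine ⟨fun v hv => hemis_subset_spheres _ (hL.1 v hv), fun v hv w hw =>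
          (hL.2 v hv w hw).trans ?_⟩
        rw [div_lt_iff₀ hε] at hM
        rw [← mul_div_assoc, div_le_iff₀ hMpos]
        linarith
      have hnil : L ≠ [] := by
        rintro rfl
        exact hne (cup_nil _)
      obtain ⟨j, a, hja⟩ := hcon L hsm hnil
      obtain ⟨v, hv, w, hw, hvw⟩ := exists_ne_of_cup_ne_zero _ _ hne (s j a)
        (List.mem_map.2 ⟨(j, s j a), List.mem_map.2 ⟨(j, a), by simp, rfl⟩, rfl⟩)
      exact hvw (hja v hv w hw)
  rw [h1, chain_zero] at h2
  exact one_ne_zero h2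

end SphereProduct

/-! ### The topology of real projective space -/

namespace RP

variable {n : ℕ}

/-- The line through a nonzero vector, as a point of `ℝPⁿ`. -/
noncomputable def ofVec (v : Fin (n + 1) → ℝ) : RP n :=
  if h : v ≠ 0 then Projectivization.mk ℝ v h
  else Projectivization.mk ℝ (Pi.single 0 1) (by simp)

theorem ofVec_of_ne {v : Fin (n + 1) → ℝ} (h : v ≠ 0) : ofVec v = Projectivization.mk ℝ v h :=
  dif_pos h

theorem ofVec_eq_iff {v w : Fin (n + 1) → ℝ} (hv : v ≠ 0) (hw : w ≠ 0) :
    ofVec v = ofVec w ↔ ∃ c : ℝ, c ≠ 0 ∧ v = c • w := by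
  rw [ofVec_of_ne hv, ofVec_of_ne hw]
  refine (Projectivization.mk_eq_mk_iff' ℝ v w hv hw).trans ?_
  constructor
  · rintro ⟨c, rfl⟩
    exact ⟨c, fun h => hv (by simp [h]), rfl⟩
  · rintro ⟨c, -, rfl⟩
    exact ⟨c, rfl⟩

theorem ofVec_smul {c : ℝ} (hc : c ≠ 0) (v : Fin (n + 1) → ℝ) : ofVec (c • v) = ofVec v := by
  by_cases hv : v = 0
  · simp [hv]
  · exact (ofVec_eq_iff (smul_ne_zero hc hv) hv).2 ⟨c, hc, rfl⟩

theorem ofVec_neg (v : Fin (n + 1) → ℝ) : ofVec (-v) = ofVec v := by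
  rw [← ofVec_smul (c := -1) (by norm_num) v, neg_one_smul]

theorem surjective_ofVec (x : RP n) : ∃ v : Fin (n + 1) → ℝ, v ≠ 0 ∧ ofVec v = x := by
  refine Projectivization.ind (P := fun x => ∃ v : Fin (n + 1) → ℝ, v ≠ 0 ∧ ofVec v = x) ?_ x
  intro v hv
  exact ⟨v, hv, ofVec_of_ne hv⟩

/-- A nonzero vector on the given line. -/
noncomputable def rep (x : RP n) : Fin (n + 1) → ℝ := (surjective_ofVec x).choose

theorem rep_ne_zero (x : RP n) : x.rep ≠ 0 := (surjective_ofVec x).choose_spec.1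

theorem ofVec_rep (x : RP n) : ofVec x.rep = x := (surjective_ofVec x).choose_spec.2

theorem isQuotientMap_mk : Topology.IsQuotientMap
    (fun v : {v : Fin (n + 1) → ℝ // v ≠ 0} => (ofVec v.1 : RP n)) := by
  have h : (fun v : {v : Fin (n + 1) → ℝ // v ≠ 0} => (ofVec v.1 : RP n)) =
      (Quotient.mk (projectivizationSetoid ℝ (Fin (n + 1) → ℝ)) : _ → RP n) := by
    ext1 v
    exact ofVec_of_ne v.2
  rw [h]
  exact isQuotientMap_quotient_mk'

theorem continuousOn_ofVec : ContinuousOn (ofVec : _ → RP n) {v | v ≠ 0} :=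
  continuousOn_iff_continuous_domRestrict.2 isQuotientMap_mk.continuous

theorem continuousAt_ofVec {v : Fin (n + 1) → ℝ} (hv : v ≠ 0) :
    ContinuousAt (ofVec : _ → RP n) v :=
  continuousOn_ofVec.continuousAt (isOpen_ne.mem_nhds hv)

theorem dotProduct_rep_ne_zero_iff {v : Fin (n + 1) → ℝ} (hv : v ≠ 0) (w : Fin (n + 1) → ℝ) :
    (ofVec v).rep ⬝ᵥ w ≠ 0 ↔ v ⬝ᵥ w ≠ 0 := by
  obtain ⟨c, hc, h⟩ := (ofVec_eq_iff (rep_ne_zero _) hv).1 (ofVec_rep (ofVec v))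
  rw [h, smul_dotProduct]
  simp [hc]

theorem isOpen_dotProduct_ne_zero (w : Fin (n + 1) → ℝ) : IsOpen {x : RP n | x.rep ⬝ᵥ w ≠ 0} := by
  rw [← isQuotientMap_mk.isOpen_preimage]
  have : (fun v : {v : Fin (n + 1) → ℝ // v ≠ 0} => (ofVec v.1 : RP n)) ⁻¹'
      {x : RP n | x.rep ⬝ᵥ w ≠ 0} = {v | v.1 ⬝ᵥ w ≠ 0} := by
    ext v
    exact dotProduct_rep_ne_zero_iff v.2 w
  rw [this]
  exact isOpen_ne_fun (by fun_prop) continuous_const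

theorem dotProduct_self_pos {v : Fin (n + 1) → ℝ} (hv : v ≠ 0) : 0 < v ⬝ᵥ v :=
  lt_of_le_of_ne (Finset.sum_nonneg fun i _ => mul_self_nonneg (v i)) fun h => hv (dotProduct_self_eq_zero.1 h.symm)

/-- The section `[v] ↦ v / ‖v‖`, with the sign such that `⟨v, w⟩ > 0`. -/
noncomputable def unitSection (w : Fin (n + 1) → ℝ) (x : RP n) : Fin (n + 1) → ℝ :=
  (Real.sqrt (((x.rep ⬝ᵥ w)⁻¹ • x.rep) ⬝ᵥ ((x.rep ⬝ᵥ w)⁻¹ • x.rep)))⁻¹ •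
    ((x.rep ⬝ᵥ w)⁻¹ • x.rep)

theorem unitSection_ofVec (w : Fin (n + 1) → ℝ) {v : Fin (n + 1) → ℝ} (hv : v ≠ 0) :
    unitSection w (ofVec v) =
      (Real.sqrt (((v ⬝ᵥ w)⁻¹ • v) ⬝ᵥ ((v ⬝ᵥ w)⁻¹ • v)))⁻¹ • ((v ⬝ᵥ w)⁻¹ • v) := by
  obtain ⟨c, hc, h⟩ := (ofVec_eq_iff (rep_ne_zero _) hv).1 (ofVec_rep (ofVec v))
  have : ((c • v) ⬝ᵥ w)⁻¹ • (c • v) = (v ⬝ᵥ w)⁻¹ • v := by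
    rw [smul_dotProduct, smul_smul, smul_eq_mul, mul_inv, mul_right_comm, inv_mul_cancel₀ hc,
      one_mul]
  rw [unitSection, h, this]

theorem ofVec_unitSection {w : Fin (n + 1) → ℝ} {x : RP n} (h : x.rep ⬝ᵥ w ≠ 0) :
    ofVec (unitSection w x) = x := by
  have h1 : (x.rep ⬝ᵥ w)⁻¹ • x.rep ≠ 0 := smul_ne_zero (inv_ne_zero h) (rep_ne_zero x)
  rw [unitSection, ofVec_smul (inv_ne_zero (Real.sqrt_ne_zero'.2 (dotProduct_self_pos h1))),
    ofVec_smul (inv_ne_zero h), ofVec_rep]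

theorem unitSection_dotProduct_self {w : Fin (n + 1) → ℝ} {x : RP n} (h : x.rep ⬝ᵥ w ≠ 0) :
    unitSection w x ⬝ᵥ unitSection w x = 1 := by
  have h1 : (x.rep ⬝ᵥ w)⁻¹ • x.rep ≠ 0 := smul_ne_zero (inv_ne_zero h) (rep_ne_zero x)
  have h2 := dotProduct_self_pos h1
  rw [unitSection]
  generalize (x.rep ⬝ᵥ w)⁻¹ • x.rep = u at h2 ⊢
  rw [smul_dotProduct, dotProduct_smul, smul_eq_mul, smul_eq_mul, ← mul_assoc,
    ← mul_inv, Real.mul_self_sqrt h2.le, inv_mul_cancel₀ h2.ne']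

theorem ne_zero_of_dotProduct_self {v : Fin (n + 1) → ℝ} (h : v ⬝ᵥ v = 1) : v ≠ 0 := by
  rintro rfl
  simp at h

theorem continuousOn_unitSection (w : Fin (n + 1) → ℝ) :
    ContinuousOn (unitSection w) {x : RP n | x.rep ⬝ᵥ w ≠ 0} := by
  rw [isQuotientMap_mk.continuousOn_isOpen_iff (isOpen_dotProduct_ne_zero w)]
  have h1 : ∀ v : {v : Fin (n + 1) → ℝ // v ≠ 0}, v ∈ (fun v : {v : Fin (n + 1) → ℝ // v ≠ 0} =>
      (ofVec v.1 : RP n)) ⁻¹' {x : RP n | x.rep ⬝ᵥ w ≠ 0} → v.1 ⬝ᵥ w ≠ 0 :=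
    fun v hv => (dotProduct_rep_ne_zero_iff v.2 w).1 hv
  have h2 : ContinuousOn (fun v : {v : Fin (n + 1) → ℝ // v ≠ 0} => (v.1 ⬝ᵥ w)⁻¹ • v.1)
      ((fun v : {v : Fin (n + 1) → ℝ // v ≠ 0} =>
      (ofVec v.1 : RP n)) ⁻¹' {x : RP n | x.rep ⬝ᵥ w ≠ 0}) :=
    ContinuousOn.smul (ContinuousOn.inv₀ (by fun_prop) h1) (by fun_prop)
  have h3 : ContinuousOn (fun v : {v : Fin (n + 1) → ℝ // v ≠ 0} =>
      (Real.sqrt (((v.1 ⬝ᵥ w)⁻¹ • v.1) ⬝ᵥ ((v.1 ⬝ᵥ w)⁻¹ • v.1)))⁻¹ • ((v.1 ⬝ᵥ w)⁻¹ • v.1))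
      ((fun v : {v : Fin (n + 1) → ℝ // v ≠ 0} =>
      (ofVec v.1 : RP n)) ⁻¹' {x : RP n | x.rep ⬝ᵥ w ≠ 0}) := by
    refine ContinuousOn.smul (ContinuousOn.inv₀ (G₀ := ℝ) ?_ ?_) h2
    · have h4 : Continuous fun u : Fin (n + 1) → ℝ => Real.sqrt (u ⬝ᵥ u) := by fun_prop
      exact h4.comp_continuousOn h2
    · intro v hv
      exact Real.sqrt_ne_zero'.2 (dotProduct_self_pos (smul_ne_zero (inv_ne_zero (h1 v hv)) v.2))
  exact h3.congr fun v _ => unitSection_ofVec w v.2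

theorem continuousAt_unitSection {w : Fin (n + 1) → ℝ} {x : RP n} (h : x.rep ⬝ᵥ w ≠ 0) :
    ContinuousAt (unitSection w) x :=
  (continuousOn_unitSection w).continuousAt ((isOpen_dotProduct_ne_zero w).mem_nhds h)

theorem rep_dotProduct_rep_ne_zero (x : RP n) : x.rep ⬝ᵥ x.rep ≠ 0 :=
  (dotProduct_self_pos (rep_ne_zero x)).ne'

/-- `rep` is not continuous, but orthogonality does not depend on representatives, so local
continuous unit sections may replace it. -/
theorem isOpen_not_orthogonal : IsOpen {p : RP n × RP n | p.1.rep ⬝ᵥ p.2.rep ≠ 0} := by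
  rw [isOpen_iff_mem_nhds]
  rintro ⟨x, y⟩ h
  have hx := rep_dotProduct_rep_ne_zero x
  have hy := rep_dotProduct_rep_ne_zero y
  have hc : ContinuousAt (fun p : RP n × RP n => unitSection x.rep p.1 ⬝ᵥ unitSection y.rep p.2)
      (x, y) := by
    have h1 : ContinuousAt (fun p : RP n × RP n => unitSection x.rep p.1) (x, y) :=
      ContinuousAt.comp (g := unitSection x.rep) (continuousAt_unitSection hx) continuousAt_fst
    have h2 : ContinuousAt (fun p : RP n × RP n => unitSection y.rep p.2) (x, y) :=
      ContinuousAt.comp (g := unitSection y.rep) (continuousAt_unitSection hy) continuousAt_snd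
    have h3 : Continuous fun q : (Fin (n + 1) → ℝ) × (Fin (n + 1) → ℝ) => q.1 ⬝ᵥ q.2 := by
      fun_prop
    exact h3.continuousAt.comp (h1.prodMk h2)
  have key : ∀ p : RP n × RP n, p.1.rep ⬝ᵥ x.rep ≠ 0 → p.2.rep ⬝ᵥ y.rep ≠ 0 →
      (p.1.rep ⬝ᵥ p.2.rep ≠ 0 ↔ unitSection x.rep p.1 ⬝ᵥ unitSection y.rep p.2 ≠ 0) := by
    rintro ⟨a, b⟩ ha hb
    have ha0 := ne_zero_of_dotProduct_self (unitSection_dotProduct_self ha)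
    have hb0 := ne_zero_of_dotProduct_self (unitSection_dotProduct_self hb)
    have e1 := dotProduct_rep_ne_zero_iff ha0 b.rep
    have e2 := dotProduct_rep_ne_zero_iff hb0 (unitSection x.rep a)
    rw [ofVec_unitSection ha] at e1
    rw [ofVec_unitSection hb, dotProduct_comm, dotProduct_comm (unitSection _ b)] at e2
    exact e1.trans e2
  have e := hc.eventually_ne ((key (x, y) hx hy).1 h)
  have e1 : ∀ᶠ p in nhds (x, y), p.1.rep ⬝ᵥ x.rep ≠ 0 :=
    ((isOpen_dotProduct_ne_zero x.rep).preimage continuous_fst).mem_nhds hx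
  have e2 : ∀ᶠ p in nhds (x, y), p.2.rep ⬝ᵥ y.rep ≠ 0 :=
    ((isOpen_dotProduct_ne_zero y.rep).preimage continuous_snd).mem_nhds hy
  filter_upwards [e, e1, e2] with p hp hp1 hp2
  exact (key p hp1 hp2).2 hp

theorem isCompact_l1Sphere : IsCompact {v : Fin (n + 1) → ℝ | ∑ m, |v m| = 1} := by
  refine Metric.isCompact_of_isClosed_isBounded (isClosed_eq (by fun_prop) continuous_const) ?_
  refine Metric.isBounded_closedBall (x := 0) (r := 1) |>.subset fun v hv => ?_
  rw [mem_closedBall_zero_iff, pi_norm_le_iff_of_nonneg zero_le_one]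
  intro i
  rw [← (show ∑ m, |v m| = 1 from hv)]
  exact Finset.single_le_sum (f := fun m => |v m|) (fun _ _ => abs_nonneg _) (Finset.mem_univ i)

theorem l1_ne_zero {v : Fin (n + 1) → ℝ} (hv : ∑ m, |v m| = 1) : v ≠ 0 := by
  rintro rfl
  simp at hv

instance : CompactSpace (RP n) := by
  constructor
  have : (ofVec '' {v : Fin (n + 1) → ℝ | ∑ m, |v m| = 1} : Set (RP n)) = univ := by
    refine eq_univ_of_forall fun x => ?_
    have hx := rep_ne_zero x
    have hpos : 0 < ∑ m, |x.rep m| := by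
      obtain ⟨m, hm⟩ := Function.ne_iff.1 hx
      exact lt_of_lt_of_le (abs_pos.2 hm)
        (Finset.single_le_sum (f := fun m => |x.rep m|) (fun _ _ => abs_nonneg _)
          (Finset.mem_univ m))
    refine ⟨(∑ m, |x.rep m|)⁻¹ • x.rep, ?_, ?_⟩
    · simp only [mem_ofPred_eq, Pi.smul_apply, smul_eq_mul, abs_mul, ← Finset.mul_sum,
        abs_inv, abs_of_pos hpos]
      exact inv_mul_cancel₀ hpos.ne'
    · rw [ofVec_smul (inv_ne_zero hpos.ne'), ofVec_rep]
  rw [← this]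
  exact isCompact_l1Sphere.image_of_continuousOn
    (continuousOn_ofVec.mono fun v hv => l1_ne_zero hv)

/-- Paths in `ℝPⁿ` lift to paths of nonzero vectors. -/
theorem exists_path_lift (γ : C(I, RP n)) : ∃ g : I → Fin (n + 1) → ℝ, Continuous g ∧
    ∀ t, g t ≠ 0 ∧ ofVec (g t) = γ t := by
  obtain ⟨t, ht0, hmono, ⟨N, hN⟩, hsub⟩ := exists_monotone_Icc_subset_open_cover_unitInterval
    (c := fun w : Fin (n + 1) → ℝ => γ ⁻¹' {x : RP n | x.rep ⬝ᵥ w ≠ 0})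
    (fun w => (isOpen_dotProduct_ne_zero w).preimage γ.continuous)
    (fun s _ => mem_iUnion.2 ⟨(γ s).rep, rep_dotProduct_rep_ne_zero _⟩)
  have key : ∀ m, ∃ g : I → Fin (n + 1) → ℝ, ContinuousOn g (Iic (t m)) ∧
      ∀ s ≤ t m, g s ≠ 0 ∧ ofVec (g s) = γ s := by
    intro m
    induction m with
    | zero =>
      rw [ht0]
      refine ⟨fun _ => (γ 0).rep, continuousOn_const, fun s hs => ?_⟩
      obtain rfl : s = 0 := le_antisymm hs unitInterval.nonneg'
      exact ⟨rep_ne_zero _, ofVec_rep _⟩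
    | succ m ih =>
      obtain ⟨g, hg, hg'⟩ := ih
      obtain ⟨w, hw⟩ := hsub m
      have hle := hmono (Nat.le_succ m)
      have hσ : ContinuousOn (fun s => unitSection w (γ s)) (Icc (t m) (t (m + 1))) :=
        (continuousOn_unitSection w).comp γ.continuous.continuousOn hw
      have h0 : (γ (t m)).rep ⬝ᵥ w ≠ 0 := hw ⟨le_rfl, hle⟩
      have hu0 := ne_zero_of_dotProduct_self (unitSection_dotProduct_self h0)
      obtain ⟨c, hc, hcg⟩ := (ofVec_eq_iff (hg' _ le_rfl).1 hu0).1
        (by rw [(hg' _ le_rfl).2, ofVec_unitSection h0])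
      refine ⟨fun s => if s ≤ t m then g s else c • unitSection w (γ s), ?_, fun s hs => ?_⟩
      · rw [← Iic_union_Icc_eq_Iic hle]
        refine ContinuousOn.union_of_isClosed ?_ ?_ isClosed_Iic isClosed_Icc
        · exact hg.congr fun s hs => if_pos hs
        · refine (hσ.const_smul c).congr fun s hs => ?_
          rcases hs.1.eq_or_lt with rfl | hlt
          · simp only [le_refl, if_true, hcg]; rfl
          · exact if_neg hlt.not_ge
      · dsimp only
        split_ifs with h
        · exact hg' s h
        · have h1 : (γ s).rep ⬝ᵥ w ≠ 0 := hw ⟨(not_le.1 h).le, hs⟩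
          exact ⟨smul_ne_zero hc (ne_zero_of_dotProduct_self (unitSection_dotProduct_self h1)),
            by rw [ofVec_smul hc, ofVec_unitSection h1]⟩
  obtain ⟨g, hg, hg'⟩ := key N
  rw [hN N le_rfl] at hg hg'
  have hu : Iic (1 : I) = univ := eq_univ_of_forall fun s => unitInterval.le_one'
  rw [hu] at hg
  exact ⟨g, continuousOn_univ.1 hg, fun s => hg' s unitInterval.le_one'⟩

end RP

/-! ### The lower bound for the parametrized topological complexity -/

namespace RP

open SphereProduct

/-- `0` if `c` is positive and `1` otherwise. -/
noncomputable def signBit (c : ℝ) : ZMod 2 := if 0 < c then 0 else 1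

theorem signBit_neg {c : ℝ} (hc : c ≠ 0) : signBit (-c) = signBit c + 1 := by
  rcases hc.lt_or_gt with h | h
  · rw [signBit, if_pos (by linarith), signBit, if_neg h.not_gt]
    exact (CharTwo.add_self_eq_zero (1 : ZMod 2)).symm
  · rw [signBit, if_neg (by linarith), signBit, if_pos h, zero_add]

theorem signBit_eq_of_mul_pos {c d : ℝ} (h : 0 < c * d) : signBit c = signBit d := by
  rcases mul_pos_iff.1 h with ⟨h1, h2⟩ | ⟨h1, h2⟩
  · rw [signBit, signBit, if_pos h1, if_pos h2]
  · rw [signBit, signBit, if_neg h1.not_gt, if_neg h2.not_gt]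

theorem mul_pos_of_forall_ne_zero {f : I → ℝ} (hf : Continuous f) (h : ∀ t, f t ≠ 0) (s t : I) :
    0 < f s * f t := by
  by_contra hle
  have hord : (f s ≤ 0 ∧ 0 ≤ f t) ∨ (0 ≤ f s ∧ f t ≤ 0) := by
    rcases mul_nonpos_iff.1 (not_lt.1 hle) with h | h
    · exact Or.inr h
    · exact Or.inl h
  rcases hord with ⟨h1, h2⟩ | ⟨h1, h2⟩
  · obtain ⟨x, hx⟩ := mem_range_of_exists_le_of_exists_ge hf ⟨s, h1⟩ ⟨t, h2⟩
    exact h x hx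
  · obtain ⟨x, hx⟩ := mem_range_of_exists_le_of_exists_ge hf ⟨t, h2⟩ ⟨s, h1⟩
    exact h x hx

/-- The base point of `ℝPⁿ`. -/
noncomputable def basePoint (n : ℕ) : RP n := ofVec (Pi.single 0 1)

theorem isOpen_forall_not_orthogonal {n : ℕ} (γ : C(I, RP n)) :
    IsOpen {γ' : C(I, RP n) | ∀ t, (γ t).rep ⬝ᵥ (γ' t).rep ≠ 0} := by
  have h1 : Continuous fun γ' : C(I, RP n) => γ.prodMk γ' :=
    ContinuousMap.continuous_of_continuous_uncurry _ (by
      change Continuous fun x : C(I, RP n) × I => (γ x.2, x.1 x.2)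
      fun_prop)
  have h2 := (ContinuousMap.isOpen_setOfPred_range_subset (X := I)
    (isOpen_not_orthogonal (n := n))).preimage h1
  convert h2 using 1
  ext γ'
  simp [range_subset_iff]

variable {n k : ℕ} {E B : Type*} [TopologicalSpace E]

/-- The point of the fibre product over `b` whose first entry is the base point of `ℝPⁿ`. -/
noncomputable def fiberTuple (p : E → B) (j : C(RP n, E)) (b : B) (hj : ∀ x, p (j x) = b)
    (x : Fin k → RP n) : FiberProduct (k + 1) p :=
  ⟨fun i => j (Fin.cons (α := fun _ => RP n) (basePoint n) x i), fun i i' => by rw [hj, hj]⟩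

theorem continuous_fiberTuple (p : E → B) (j : C(RP n, E)) (b : B) (hj : ∀ x, p (j x) = b) :
    Continuous (fiberTuple (k := k) p j b hj) := by
  refine Continuous.subtype_mk (continuous_pi fun i => j.continuous.comp ?_) _
  refine Fin.cases ?_ (fun i => ?_) i
  · simpa using continuous_const
  · simpa using continuous_apply i

theorem ne_zero_of_mem_spheres {v : Vecs k n} (hv : v ∈ spheres k n) (a : Fin k) : v a ≠ 0 :=
  l1_ne_zero (hv a)

theorem ofVec_antipode (a i : Fin k) (v : Vecs k n) : ofVec (antipode a v i) = ofVec (v i) := by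
  by_cases h : i = a
  · subst h; rw [antipode_self, ofVec_neg]
  · rw [antipode_ne h]

theorem continuousAt_ofVec_pi {v : Vecs k n} (hv : v ∈ spheres k n) :
    ContinuousAt (fun (w : Vecs k n) a => ofVec (w a)) v :=
  continuousAt_pi.2 fun a =>
    ContinuousAt.comp (g := ofVec) (continuousAt_ofVec (ne_zero_of_mem_spheres hv a))
      (continuous_apply a).continuousAt

/-- Over an open set on which `Π_r` has a section, following the paths given by the section yields
a locally constant function that is odd in the chosen variable. -/
theorem exists_isOdd_of_section [T2Space E] (p : E → B) (j : C(RP n, E))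
    (hinj : Function.Injective j) (b : B) (hj : ∀ x, p (j x) = b)
    (hrange : ∀ e, p e = b → e ∈ range j) (U : Set (FiberProduct (k + 1) p)) (hU : IsOpen U)
    (sec : C(U, FiberwisePath p)) (hsec : ∀ x : U, endpointMap (k + 1) p (sec x) = x) (a : Fin k) :
    ∃ s : Vecs k n → ZMod 2, IsOdd a s ∧ ∀ v ∈ spheres k n,
      fiberTuple p j b hj (fun i => ofVec (v i)) ∈ U →
        ∀ᶠ w in nhdsWithin v (spheres k n), s w = s v := by
  classical
  set Ψ : (Fin k → RP n) → FiberProduct (k + 1) p := fiberTuple p j b hj with hΨ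
  -- A continuous injection from a compact space to a Hausdorff one; paths in the fibre thus pull
  -- back to `ℝPⁿ`, continuously in the compact-open topology.
  have hemb : Topology.IsEmbedding j :=
    (Topology.IsClosedEmbedding.of_continuous_injective_isClosedMap j.continuous hinj
      j.continuous.isClosedMap).isEmbedding
  have hend : ∀ (z : U) i, (sec z).1 (sampleTime (k + 1) i) = z.1.1 i := fun z i =>
    congrFun (congrArg Subtype.val (hsec z)) i
  have hfib : ∀ x (hx : Ψ x ∈ U) t, (sec ⟨Ψ x, hx⟩).1 t ∈ range j := by
    intro x hx t
    apply hrange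
    obtain ⟨b', hb'⟩ := (sec ⟨Ψ x, hx⟩).2
    rw [hb' t, ← hb' (sampleTime (k + 1) 0), hend]
    exact hj _
  have hpath : ∀ x (hx : Ψ x ∈ U), ∃ γ : C(I, RP n), j.comp γ = (sec ⟨Ψ x, hx⟩).1 := by
    intro x hx
    choose γ hγ using hfib x hx
    refine ⟨⟨γ, hemb.continuous_iff.2 ?_⟩, ?_⟩
    · have : j ∘ γ = (sec ⟨Ψ x, hx⟩).1 := funext hγ
      rw [this]
      exact (sec ⟨Ψ x, hx⟩).1.continuous
    · ext t; exact hγ t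
  choose Γ hΓ using hpath
  have hΓend : ∀ x hx i, Γ x hx (sampleTime (k + 1) i) =
      Fin.cons (α := fun _ => RP n) (basePoint n) x i := by
    intro x hx i
    apply hinj
    have := hend ⟨Ψ x, hx⟩ i
    rw [← hΓ x hx] at this
    exact this
  choose G hGc hG using fun x hx => exists_path_lift (Γ x hx)
  set t0 := sampleTime (k + 1) 0
  set t1 := sampleTime (k + 1) a.succ
  have he0 : (Pi.single 0 1 : Fin (n + 1) → ℝ) ≠ 0 := by simp
  have hG0 : ∀ x hx, ∃ c : ℝ, c ≠ 0 ∧ G x hx t0 = c • Pi.single 0 1 := by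
    intro x hx
    rw [← ofVec_eq_iff (hG x hx t0).1 he0, (hG x hx t0).2, hΓend]
    rfl
  have hG1 : ∀ v ∈ spheres k n, ∀ hx, ∃ c : ℝ, c ≠ 0 ∧
      G (fun i => ofVec (v i)) hx t1 = c • v a := by
    intro v hv hx
    rw [← ofVec_eq_iff (hG _ hx t1).1 (ne_zero_of_mem_spheres hv a), (hG _ hx t1).2, hΓend]
    simp
  have he00 : (Pi.single 0 1 : Fin (n + 1) → ℝ) ⬝ᵥ Pi.single 0 1 = 1 := by simp
  -- The endpoint of the lift, signed by its starting point, so that replacing the lift by its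
  -- negative changes nothing. It depends only on the lines, hence pairing it with `v a` is odd in
  -- `v a` and even elsewhere. Outside `U` any vector on the line serves, as only parity is needed
  -- there.
  set c : (Fin k → RP n) → (Fin (n + 1) → ℝ) := fun x =>
    if hx : Ψ x ∈ U then (G x hx t0 ⬝ᵥ Pi.single 0 1) • G x hx t1 else (x a).rep with hc
  have hcne : ∀ v ∈ spheres k n, c (fun i => ofVec (v i)) ⬝ᵥ v a ≠ 0 := by
    intro v hv
    have hva := ne_zero_of_mem_spheres hv a
    simp only [hc]
    split_ifs with hx
    · obtain ⟨c0, h0, e0⟩ := hG0 _ hx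
      obtain ⟨c1, h1, e1⟩ := hG1 v hv hx
      simp only [e0, e1, smul_dotProduct, he00]
      simp [h0, h1, (dotProduct_self_pos hva).ne']
    · rw [dotProduct_rep_ne_zero_iff hva]
      exact (dotProduct_self_pos hva).ne'
  refine ⟨fun v => signBit (c (fun i => ofVec (v i)) ⬝ᵥ v a), fun v hv => ⟨?_, fun i hi => ?_⟩,
    fun v hv hx => ?_⟩
  · simp only [ofVec_antipode, antipode_self, dotProduct_neg]
    exact signBit_neg (hcne v hv)
  · simp only [ofVec_antipode, antipode_ne hi.symm]
  · set D : Type := {w : Vecs k n // w ∈ spheres k n ∧ Ψ (fun i => ofVec (w i)) ∈ U} with hD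
    have hcont : Continuous fun w : D => (fun i => ofVec (w.1 i) : Fin k → RP n) :=
      continuous_iff_continuousAt.2 fun w =>
        ContinuousAt.comp (g := fun (w : Vecs k n) a => ofVec (w a))
          (continuousAt_ofVec_pi w.2.1) continuous_subtype_val.continuousAt
    have hΓc : Continuous fun w : D => Γ (fun i => ofVec (w.1 i)) w.2.2 := by
      rw [(ContinuousMap.isEmbedding_postcomp j hemb).continuous_iff]
      have : (j.comp ∘ fun w : D => Γ (fun i => ofVec (w.1 i)) w.2.2) =
          fun w : D => (sec ⟨Ψ (fun i => ofVec (w.1 i)), w.2.2⟩).1 := funext fun w => hΓ _ _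
      rw [this]
      exact continuous_subtype_val.comp (sec.continuous.comp
        (((continuous_fiberTuple p j b hj).comp hcont).subtype_mk _))
    have hUv : ∀ᶠ w in nhdsWithin v (spheres k n), Ψ (fun i => ofVec (w i)) ∈ U := by
      have : ContinuousAt (fun w : Vecs k n => Ψ (fun i => ofVec (w i))) v :=
        ContinuousAt.comp (g := Ψ) (continuous_fiberTuple p j b hj).continuousAt
          (continuousAt_ofVec_pi hv)
      exact (this.eventually (hU.mem_nhds hx)).filter_mono nhdsWithin_le_nhds
    set v' : D := ⟨v, hv, hx⟩
    have hev1 : ∀ᶠ w : D in nhds v', ∀ t,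
        (Γ (fun i => ofVec (v i)) hx t).rep ⬝ᵥ (Γ (fun i => ofVec (w.1 i)) w.2.2 t).rep ≠ 0 :=
      ((isOpen_forall_not_orthogonal (Γ (fun i => ofVec (v i)) hx)).preimage hΓc).mem_nhds
        fun t => rep_dotProduct_rep_ne_zero _
    have hev2 : ∀ᶠ w : D in nhds v', 0 < v a ⬝ᵥ w.1 a := by
      have hcd : Continuous fun w : D => v a ⬝ᵥ w.1 a :=
        continuous_const.dotProduct ((continuous_apply a).comp continuous_subtype_val)
      exact hcd.continuousAt.eventually (lt_mem_nhds
        (dotProduct_self_pos (ne_zero_of_mem_spheres hv a)))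
    have hev : ∀ᶠ w : D in nhds v', signBit (c (fun i => ofVec (w.1 i)) ⬝ᵥ w.1 a) =
        signBit (c (fun i => ofVec (v i)) ⬝ᵥ v a) := by
      filter_upwards [hev1, hev2] with w hw1 hw2
      obtain ⟨w, hw, hwU⟩ := w
      dsimp only at hw1 hw2 ⊢
      have hne : ∀ t, G (fun i => ofVec (v i)) hx t ⬝ᵥ G (fun i => ofVec (w i)) hwU t ≠ 0 := by
        intro t
        have h1 := hw1 t
        rw [← (hG _ hx t).2, ← (hG _ hwU t).2, dotProduct_rep_ne_zero_iff (hG _ hx t).1,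
          dotProduct_comm, dotProduct_rep_ne_zero_iff (hG _ hwU t).1, dotProduct_comm] at h1
        exact h1
      -- Nearby paths are never orthogonal, so the pairing of their lifts has constant sign;
      -- comparing both ends shows that the two chosen signs agree.
      have hpos := mul_pos_of_forall_ne_zero
        (f := fun t => G (fun i => ofVec (v i)) hx t ⬝ᵥ G (fun i => ofVec (w i)) hwU t)
        ((hGc _ hx).dotProduct (hGc _ hwU)) hne t0 t1
      obtain ⟨c0, h0, e0⟩ := hG0 _ hx
      obtain ⟨c1, h1, e1⟩ := hG1 v hv hx
      obtain ⟨d0, k0, f0⟩ := hG0 _ hwU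
      obtain ⟨d1, k1, f1⟩ := hG1 w hw hwU
      have hvv := dotProduct_self_pos (ne_zero_of_mem_spheres hv a)
      have hww := dotProduct_self_pos (ne_zero_of_mem_spheres hw a)
      simp only [e0, e1, f0, f1, smul_dotProduct, dotProduct_smul, he00, smul_eq_mul] at hpos
      apply signBit_eq_of_mul_pos
      simp only [hc, dif_pos hx, dif_pos hwU, e0, e1, f0, f1, smul_dotProduct, he00, smul_eq_mul]
      have h3 : 0 < c0 * d0 * (c1 * d1) := by
        have h4 : 0 < (c0 * d0 * (c1 * d1)) * (v a ⬝ᵥ w a) := by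
          convert hpos using 1; ring
        exact pos_of_mul_pos_left h4 hw2.le
      have : 0 < (c0 * d0 * (c1 * d1)) * ((v a ⬝ᵥ v a) * (w a ⬝ᵥ w a)) := by positivity
      convert this using 1
      ring
    rw [nhds_subtype_eq_comap, Filter.eventually_comap] at hev
    have hev' := hev.filter_mono (nhdsWithin_le_nhds (s := spheres k n))
    filter_upwards [hev', hUv, self_mem_nhdsWithin] with w h1 h2 h3
    exact h1 ⟨w, h3, h2⟩ rfl

/-- If the fibre of `p` over `b` is homeomorphic to `ℝPⁿ`, then `TC_r[p] ≥ n (r - 1)`. -/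
theorem le_parametrizedTC [T2Space E] (p : E → B) (j : C(RP n, E))
    (hinj : Function.Injective j) (b : B) (hj : ∀ x, p (j x) = b)
    (hrange : ∀ e, p e = b → e ∈ range j) :
    ((n * k : ℕ) : ℕ∞) ≤ parametrizedTC (k + 1) p := by
  refine le_sInf ?_
  rintro _ ⟨N, rfl, U, hUo, hUc, hsec⟩
  rw [Nat.cast_le]
  by_contra hlt
  rw [not_le, mul_comm] at hlt
  choose sec hsec using hsec
  -- As `N + 1 ≤ n * k`, truncation gives a surjection: every open set is assigned to some pair
  -- (variable, copy).
  set l : Fin k × Fin n → Fin (N + 1) := fun q =>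
    ⟨min (finProdFinEquiv q) N, by omega⟩ with hl
  have hlsurj : Function.Surjective l := by
    intro i
    refine ⟨finProdFinEquiv.symm ⟨i, by omega⟩, Fin.ext ?_⟩
    simp only [hl, Equiv.apply_symm_apply]
    omega
  choose s hs hloc using fun q : Fin k × Fin n => exists_isOdd_of_section p j hinj b hj hrange
    (U (l q)) (hUo (l q)) (sec (l q)) (hsec (l q)) q.1
  have hcover : ∀ v : Vecs k n, ∃ q, fiberTuple p j b hj (fun i => ofVec (v i)) ∈ U (l q) := by
    intro v
    obtain ⟨i, hi⟩ := mem_iUnion.1 (hUc ▸ mem_univ (fiberTuple p j b hj (fun i => ofVec (v i))))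
    obtain ⟨q, rfl⟩ := hlsurj i
    exact ⟨q, hi⟩
  choose q hq using hcover
  have hK : IsCompact (spheres k n) := by
    have h := isCompact_univ_pi fun _ : Fin k => isCompact_l1Sphere (n := n)
    convert h using 1
    ext v
    simp [spheres]
  obtain ⟨δ, hδ, hball⟩ := lebesgue_number_lemma_of_emetric_nhdsWithin
    (c := fun v => {w | s (q v) w = s (q v) v}) hK fun v hv => hloc (q v) v hv (hq v)
  obtain ⟨ε, hε, hεδ⟩ := ENNReal.lt_iff_exists_real_btwn.1 hδ
  obtain ⟨L, hL, hLne, hL'⟩ := exists_small_forall_ne (fun a c => s (a, c))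
    (fun a c => hs (a, c)) (ε := ε) (by simpa using hεδ.1)
  obtain ⟨x, hx⟩ := List.exists_mem_of_ne_nil L hLne
  obtain ⟨y, hy⟩ := hball x (hL.1 x hx)
  have hconst : ∀ w ∈ L, s (q y) w = s (q y) y := fun w hw => by
    refine hy ⟨?_, hL.1 w hw⟩
    rw [Metric.mem_eball, edist_dist]
    exact (ENNReal.ofReal_le_ofReal (hL.2 w hw x hx)).trans_lt hεδ.2
  obtain ⟨v, hv, w, hw, hvw⟩ := hL' (q y).1 (q y).2
  exact hvw ((hconst v hv).trans (hconst w hw).symm)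

end RP

/-! ### The fibres of the associated bundle -/

namespace IsPrincipalBundle

variable {G P B : Type*} [Group G] [TopologicalSpace G] [TopologicalSpace P] [TopologicalSpace B]
  [MulAction G P] {q : P → B}

theorem eq_one_of_smul_eq (h : IsPrincipalBundle G q) {g : G} {y : P} (hg : g • y = y) :
    g = 1 := by
  obtain ⟨e, hb, he⟩ := h.locally_trivial (q y)
  have := he g y hb
  rw [hg] at this
  simpa using this.symm

variable {F : Type*} [MulAction G F]

theorem mk_injective (h : IsPrincipalBundle G q) (y : P) :
    Function.Injective fun x : F => (Quotient.mk _ (x, y) : AssocBundle G F P) := by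
  intro x x' hxx
  obtain ⟨g, hg⟩ := Quotient.exact hxx
  obtain ⟨h1, h2⟩ := Prod.ext_iff.1 hg
  obtain rfl := h.eq_one_of_smul_eq h2
  simpa using h1.symm

end IsPrincipalBundle

theorem mem_range_mk_of_assocProj_eq {G F P : Type*} [Group G] [MulAction G F] [MulAction G P]
    (y : P) (z : AssocBundle G F P) (h : assocProj G F P z = Quotient.mk _ y) :
    z ∈ range fun x : F => (Quotient.mk _ (x, y) : AssocBundle G F P) := by
  induction z using Quotient.inductionOn with
  | h z =>
    obtain ⟨x, y'⟩ := z
    obtain ⟨g, hg⟩ := Quotient.exact h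
    refine ⟨g⁻¹ • x, Quotient.sound ⟨g⁻¹, ?_⟩⟩
    ext
    · rfl
    · have hg' : g • y = y' := hg
      change g⁻¹ • y' = y
      rw [← hg', inv_smul_smul]

theorem continuous_mk_left {G F P : Type*} [Group G] [MulAction G F] [MulAction G P]
    [TopologicalSpace F] [TopologicalSpace P] (y : P) :
    Continuous fun x : F => (Quotient.mk _ (x, y) : AssocBundle G F P) :=
  continuous_quotient_mk'.comp (by fun_prop)

/-! ### Finite sums of Dirac measures -/

namespace FinProb

variable {ι Y : Type*} [Fintype ι]

/-- The measure `∑ aᵢ δ_{yᵢ}`. -/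
noncomputable def sumDirac [TopologicalSpace Y] (a : ι → ℝ) (y : ι → Y) : @Measure Y (borel Y) :=
  letI : MeasurableSpace Y := borel Y
  ∑ i, ENNReal.ofReal (a i) • Measure.dirac (y i)

theorem sumDirac_apply [TopologicalSpace Y] (a : ι → ℝ) (y : ι → Y) {s : Set Y}
    (hs : @MeasurableSet Y (borel Y) s) :
    sumDirac a y s = ∑ i, ENNReal.ofReal (a i) * s.indicator 1 (y i) := by
  let _ : MeasurableSpace Y := borel Y
  simp only [sumDirac, Measure.coe_finsetSum, Finset.sum_apply, Measure.smul_apply, smul_eq_mul]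
  exact Finset.sum_congr rfl fun i _ => by rw [Measure.dirac_apply' _ hs]

theorem sumDirac_congr [TopologicalSpace Y] {a a' : ι → ℝ} {y y' : ι → Y} (e : ι ≃ ι)
    (ha : ∀ i, a' i = a (e i)) (hy : ∀ i, a (e i) ≠ 0 → y' i = y (e i)) :
    sumDirac a' y' = sumDirac a y := by
  let _ : MeasurableSpace Y := borel Y
  rw [sumDirac, sumDirac,
    ← e.sum_comp fun i => ENNReal.ofReal (a i) • Measure.dirac (y i)]
  refine Finset.sum_congr rfl fun i _ => ?_
  rw [ha]
  by_cases h : a (e i) = 0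
  · simp [h]
  · rw [hy i h]

theorem isProbabilityMeasure_sumDirac [TopologicalSpace Y] (a : ι → ℝ) (y : ι → Y)
    (h0 : ∀ i, 0 ≤ a i) (h1 : ∑ i, a i = 1) :
    @IsProbabilityMeasure Y (borel Y) (sumDirac a y) := by
  let _ : MeasurableSpace Y := borel Y
  refine ⟨?_⟩
  rw [sumDirac_apply a y MeasurableSet.univ]
  simp [← ENNReal.ofReal_sum_of_nonneg fun i _ => h0 i, h1]

/-- The measure `∑ aᵢ δ_{yᵢ}` as a point of `𝓑ₖ(Y)`. -/
noncomputable def ofSum [TopologicalSpace Y] [T1Space Y] {k : ℕ} (hk : Fintype.card ι ≤ k)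
    (a : ι → ℝ) (y : ι → Y) (h0 : ∀ i, 0 ≤ a i) (h1 : ∑ i, a i = 1) : FinProb k Y := by
  classical
  refine ⟨⟨sumDirac a y, isProbabilityMeasure_sumDirac a y h0 h1⟩, Finset.univ.image y,
    Finset.card_image_le.trans hk, ?_⟩
  let _ : MeasurableSpace Y := borel Y
  have _ : BorelSpace Y := ⟨rfl⟩
  refine (sumDirac_apply a y (Finset.measurableSet _).compl).trans ?_
  simp

theorem ofSum_congr [TopologicalSpace Y] [T1Space Y] {k : ℕ} (hk : Fintype.card ι ≤ k)
    {a a' : ι → ℝ} {y y' : ι → Y} (h0 : ∀ i, 0 ≤ a i) (h1 : ∑ i, a i = 1)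
    (h0' : ∀ i, 0 ≤ a' i) (h1' : ∑ i, a' i = 1) (e : ι ≃ ι)
    (ha : ∀ i, a' i = a (e i)) (hy : ∀ i, a (e i) ≠ 0 → y' i = y (e i)) :
    ofSum hk a' y' h0' h1' = ofSum hk a y h0 h1 :=
  Subtype.ext (Subtype.ext (sumDirac_congr e ha hy))

theorem exists_of_mem_supp_ofSum [TopologicalSpace Y] [T1Space Y] {k : ℕ}
    (hk : Fintype.card ι ≤ k) (a : ι → ℝ) (y : ι → Y) (h0 : ∀ i, 0 ≤ a i) (h1 : ∑ i, a i = 1)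
    {z : Y} (hz : z ∈ (ofSum hk a y h0 h1).supp) : ∃ i, a i ≠ 0 ∧ y i = z := by
  let _ : MeasurableSpace Y := borel Y
  have _ : BorelSpace Y := ⟨rfl⟩
  have h : 0 < sumDirac a y {z} := hz
  rw [sumDirac_apply a y (MeasurableSet.singleton z)] at h
  by_contra hcon
  push Not at hcon
  refine h.ne' (Finset.sum_eq_zero fun i _ => ?_)
  by_cases hi : a i = 0
  · simp [hi]
  · simp [hcon i hi]

/-- Atoms of weight zero at `x₀` may jump, since their nearby mass is absorbed by the change of
weights. Atoms of nonzero weight move little, and both effects are bounded by `ε / 2` in the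
Lévy–Prokhorov distance. -/
theorem continuousAt_of_eq_sumDirac {X : Type*} [TopologicalSpace X] [MetricSpace Y] {k : ℕ}
    (μ : X → FinProb k Y) (a : X → ι → ℝ) (y : X → ι → Y)
    (hμ : ∀ x, @ProbabilityMeasure.toMeasure Y (borel Y) (μ x).1 = sumDirac (a x) (y x))
    (x₀ : X) (h0 : ∀ i, 0 ≤ a x₀ i) (ha : ContinuousAt a x₀)
    (hy : ∀ i, a x₀ i ≠ 0 → ContinuousAt (fun x => y x i) x₀) : ContinuousAt μ x₀ := by
  let _ : MeasurableSpace Y := borel Y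
  have _ : BorelSpace Y := ⟨rfl⟩
  have hind : Topology.IsInducing (FinProb.toLP : FinProb k Y → _) := ⟨rfl⟩
  rw [hind.continuousAt_iff, Metric.continuousAt_iff']
  intro ε hε
  have e1 : ∀ᶠ x in nhds x₀, ∀ i, a x₀ i ≠ 0 → dist (y x i) (y x₀ i) < ε / 2 := by
    rw [Filter.eventually_all]
    intro i
    by_cases hi : a x₀ i = 0
    · simp [hi]
    · filter_upwards [Metric.continuousAt_iff'.1 (hy i hi) (ε / 2) (by positivity)] with x hx _
      exact hx
  have e2 : ∀ᶠ x in nhds x₀, ∑ i, |a x i - a x₀ i| < ε / 2 := by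
    have hc : ContinuousAt (fun x => ∑ i, |a x i - a x₀ i|) x₀ := by
      refine tendsto_finsetSum _ fun i _ => ?_
      have := (continuousAt_pi.1 ha i)
      exact (this.sub continuousAt_const).abs
    have h : (fun x => ∑ i, |a x i - a x₀ i|) x₀ < ε / 2 := by
      simp only [sub_self, abs_zero, Finset.sum_const_zero]; positivity
    exact hc.eventually (gt_mem_nhds h)
  filter_upwards [e1, e2] with x hx1 hx2
  refine lt_of_le_of_lt ?_ (half_lt_self hε)
  rw [Function.comp_apply, Function.comp_apply, LevyProkhorov.dist_probabilityMeasure_def]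
  refine levyProkhorovDist_le_of_forall_le _ _ (by positivity) fun δ s hδ hs => ?_
  have hm : ∀ x, ((FinProb.toLP (μ x)).toMeasure : Measure Y) = sumDirac (a x) (y x) := hμ
  rw [hm, hm, sumDirac_apply _ _ hs, sumDirac_apply _ _ Metric.isOpen_thickening.measurableSet]
  calc ∑ i, ENNReal.ofReal (a x i) * s.indicator 1 (y x i)
      ≤ ∑ i, (ENNReal.ofReal (a x₀ i) * (Metric.thickening δ s).indicator 1 (y x₀ i) +
          ENNReal.ofReal |a x i - a x₀ i|) := by
        refine Finset.sum_le_sum fun i _ => ?_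
        by_cases hxs : y x i ∈ s
        · have hle : ENNReal.ofReal (a x i) ≤
              ENNReal.ofReal (a x₀ i) + ENNReal.ofReal |a x i - a x₀ i| := by
            rw [← ENNReal.ofReal_add (h0 i) (abs_nonneg _)]
            exact ENNReal.ofReal_le_ofReal (by linarith [le_abs_self (a x i - a x₀ i)])
          by_cases hi : a x₀ i = 0
          · simpa [hxs, hi] using hle
          · have : y x₀ i ∈ Metric.thickening δ s :=
              Metric.mem_thickening_iff.2 ⟨y x i, hxs, by
                rw [dist_comm]; exact (hx1 i hi).trans hδ⟩
            simpa [hxs, this] using hle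
        · simp [hxs]
    _ ≤ _ := by
        rw [Finset.sum_add_distrib, ← ENNReal.ofReal_sum_of_nonneg fun i _ => abs_nonneg _]
        gcongr
        linarith

end FinProb

/-! ### Weighted spherical polygons -/

namespace RP

/-- Families of `r` unit vectors in `ℝⁿ⁺¹`. -/
abbrev UnitVecs (r n : ℕ) : Type := Fin r → {v : Fin (n + 1) → ℝ // v ⬝ᵥ v = 1}

variable {r n : ℕ}

/-- A weight that vanishes if and only if two consecutive vectors are antipodal. -/
def weight (w : UnitVecs r n) : ℝ :=
  ∏ i : Fin r, ∏ j : Fin r, if (i : ℕ) + 1 = j then 1 + (w i).1 ⬝ᵥ (w j).1 else 1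

theorem one_add_dotProduct_nonneg {v w : Fin (n + 1) → ℝ} (hv : v ⬝ᵥ v = 1) (hw : w ⬝ᵥ w = 1) :
    0 ≤ 1 + v ⬝ᵥ w := by
  have h : 0 ≤ (v + w) ⬝ᵥ (v + w) := Finset.sum_nonneg fun i _ => mul_self_nonneg _
  simp only [add_dotProduct, dotProduct_add, hv, hw, dotProduct_comm w v] at h
  linarith

theorem weight_nonneg (w : UnitVecs r n) : 0 ≤ weight w := by
  refine Finset.prod_nonneg fun i _ => Finset.prod_nonneg fun j _ => ?_
  split_ifs
  · exact one_add_dotProduct_nonneg (w i).2 (w j).2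
  · exact zero_le_one

theorem continuous_weight : Continuous (weight : UnitVecs r n → ℝ) := by
  refine continuous_finsetProd _ fun i _ => continuous_finsetProd _ fun j _ => ?_
  split_ifs
  · exact continuous_const.add ((continuous_subtype_val.comp (continuous_apply i)).dotProduct
      (continuous_subtype_val.comp (continuous_apply j)))
  · exact continuous_const

/-- The polygonal path through the given vectors at the times `i / (r - 1)`. -/
noncomputable def polygon (w : UnitVecs r n) (t : I) : Fin (n + 1) → ℝ :=
  ∑ i : Fin r, max 0 (1 - |((r : ℝ) - 1) * t - i|) • (w i).1

theorem continuous_polygon : Continuous fun x : UnitVecs r n × I => polygon x.1 x.2 := by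
  refine continuous_finsetSum _ fun i _ => Continuous.smul
    (f := fun x : UnitVecs r n × I => max 0 (1 - |((r : ℝ) - 1) * x.2 - i|)) (by fun_prop) ?_
  exact continuous_subtype_val.comp ((continuous_apply i).comp continuous_fst)

theorem polygon_sampleTime (hr : 2 ≤ r) (w : UnitVecs r n) (i : Fin r) :
    polygon w (sampleTime r i) = (w i).1 := by
  have hr' : (r : ℝ) - 1 ≠ 0 := by
    have : (2 : ℝ) ≤ r := by exact_mod_cast hr
    linarith
  have ht : ((r : ℝ) - 1) * (sampleTime r i : ℝ) = i := by
    simp only [sampleTime]; field_simp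
  rw [polygon, Finset.sum_eq_single i]
  · rw [ht]; simp
  · intro j _ hj
    rw [ht]
    have h1 : (1 : ℝ) ≤ |(i : ℝ) - j| := by
      have h2 : (i : ℤ) - j ≠ 0 := by
        have := fun h => hj (Fin.ext h)
        omega
      exact_mod_cast Int.one_le_abs h2
    rw [max_eq_left (by linarith), zero_smul]
  · simp

/-- On the segment from `wᵢ` to `wⱼ`, pairing with `wᵢ + wⱼ` is constantly `1 + ⟨wᵢ, wⱼ⟩`, a factor
of the weight. -/
theorem polygon_ne_zero (hr : 2 ≤ r) {w : UnitVecs r n} (hw : weight w ≠ 0) (t : I) :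
    polygon w t ≠ 0 := by
  have hr' : (2 : ℝ) ≤ r := by exact_mod_cast hr
  set x : ℝ := ((r : ℝ) - 1) * t with hx
  have hx0 : 0 ≤ x := mul_nonneg (by linarith) t.2.1
  have hx1 : x ≤ (r : ℝ) - 1 := mul_le_of_le_one_right (by linarith) t.2.2
  -- The minimum puts the endpoint `t = 1` on the last segment.
  set m := min ⌊x⌋₊ (r - 2) with hm
  have hmx : (m : ℝ) ≤ x := le_trans (by exact_mod_cast min_le_left _ _) (Nat.floor_le hx0)
  have hxm : x ≤ m + 1 := by
    rcases min_cases ⌊x⌋₊ (r - 2) with ⟨h, -⟩ | ⟨h, -⟩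
    · rw [hm, h]; exact (Nat.lt_floor_add_one x).le
    · rw [hm, h, Nat.cast_sub hr]; push_cast; linarith
  have hmr : m + 1 < r := by omega
  set i : Fin r := ⟨m, by omega⟩ with hi
  set j : Fin r := ⟨m + 1, hmr⟩ with hj
  have hij : 1 + (w i).1 ⬝ᵥ (w j).1 ≠ 0 := by
    have h1 := Finset.prod_ne_zero_iff.1 (Finset.prod_ne_zero_iff.1 hw i (Finset.mem_univ i)) j
      (Finset.mem_univ j)
    rwa [if_pos rfl] at h1
  have hne : i ≠ j := by simp [hi, hj, Fin.ext_iff]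
  have hp : polygon w t = (1 - (x - m)) • (w i).1 + (x - m) • (w j).1 := by
    rw [polygon, Fintype.sum_eq_add i j hne]
    · congr 2
      · rw [← hx, abs_of_nonneg (by simp only [hi]; linarith), max_eq_right]
        simp only [hi]; linarith
      · rw [← hx, abs_of_nonpos (by simp only [hj]; push_cast; linarith), max_eq_right]
        · simp only [hj]; push_cast; ring
        · simp only [hj]; push_cast; linarith
    · rintro l ⟨hli, hlj⟩
      rw [← hx, max_eq_left, zero_smul]
      have h1 : (l : ℕ) ≠ m := fun h => hli (Fin.ext h)
      have h2 : (l : ℕ) ≠ m + 1 := fun h => hlj (Fin.ext h)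
      rcases lt_or_gt_of_ne h1 with h | h
      · have : (l : ℝ) + 1 ≤ m := by exact_mod_cast h
        linarith [le_abs_self (x - l)]
      · have : (m : ℝ) + 2 ≤ l := by
          have : m + 2 ≤ l := by omega
          exact_mod_cast this
        linarith [neg_abs_le (x - l)]
  intro h0
  apply hij
  have h1 : polygon w t ⬝ᵥ ((w i).1 + (w j).1) = 1 + (w i).1 ⬝ᵥ (w j).1 := by
    rw [hp]
    simp only [add_dotProduct, dotProduct_add, smul_dotProduct, (w i).2, (w j).2, smul_eq_mul,
      dotProduct_comm (w j).1 (w i).1]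
    ring
  rw [← h1, h0, zero_dotProduct]

/-! ### Sign choices and their normalized weights. -/

/-- Multiplication of unit vectors by signs. -/
def twist (ρ : Fin r → ℤˣ) (v : UnitVecs r n) : UnitVecs r n := fun i =>
  ⟨((ρ i : ℤ) : ℝ) • (v i).1, by
    have h : (((ρ i : ℤ) : ℝ)) * ((ρ i : ℤ) : ℝ) = 1 := by
      rw [← Int.cast_mul, ← Units.val_mul, Int.units_mul_self]; simp
    rw [smul_dotProduct, dotProduct_smul, (v i).2, smul_eq_mul, smul_eq_mul, mul_one, h]⟩

theorem twist_val (ρ : Fin r → ℤˣ) (v : UnitVecs r n) (i : Fin r) :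
    (twist ρ v i).1 = ((ρ i : ℤ) : ℝ) • (v i).1 := rfl

theorem continuous_twist (ρ : Fin r → ℤˣ) : Continuous (twist ρ : UnitVecs r n → _) := by
  refine continuous_pi fun i => Continuous.subtype_mk ?_ _
  have h : Continuous fun v : UnitVecs r n => (v i).1 :=
    continuous_subtype_val.comp (continuous_apply i)
  exact h.const_smul ((ρ i : ℤ) : ℝ)

theorem unit_cast_ne_zero (ρ : ℤˣ) : ((ρ : ℤ) : ℝ) ≠ 0 := by
  exact_mod_cast ρ.ne_zero

/-- Choose the signs recursively so that consecutive inner products are nonnegative; every factor is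
then at least 1. -/
theorem exists_weight_twist_pos (v : UnitVecs r n) : ∃ ρ, 0 < weight (twist ρ v) := by
  classical
  set u : ℕ → Fin (n + 1) → ℝ := fun i => if h : i < r then (v ⟨i, h⟩).1 else 0 with hu
  set f : ℕ → ℤˣ := fun i => Nat.rec (motive := fun _ => ℤˣ) 1
    (fun i s => if 0 ≤ (((s : ℤ) : ℝ) • u i) ⬝ᵥ u (i + 1) then 1 else -1) i with hf
  have key : ∀ i, 0 ≤ (((f i : ℤ) : ℝ) • u i) ⬝ᵥ (((f (i + 1) : ℤ) : ℝ) • u (i + 1)) := by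
    intro i
    have hs : f (i + 1) = if 0 ≤ (((f i : ℤ) : ℝ) • u i) ⬝ᵥ u (i + 1) then 1 else -1 := rfl
    rw [hs]
    split_ifs with h
    · simpa using h
    · simp only [dotProduct_smul, Units.val_neg, Units.val_one, Int.cast_neg, Int.cast_one,
        smul_eq_mul]
      linarith
  refine ⟨fun i => f i, Finset.prod_pos fun i _ => Finset.prod_pos fun j _ => ?_⟩
  split_ifs with h
  · have := key i
    simp only [hu, i.2, h, j.2, dif_pos] at this
    simp only [twist_val]
    linarith
  · exact zero_lt_one

/-- The weights `weight (ρ v)`, normalized to have sum `1`. -/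
noncomputable def normWeight (v : UnitVecs r n) (ρ : Fin r → ℤˣ) : ℝ :=
  weight (twist ρ v) / ∑ ρ', weight (twist ρ' v)

theorem sum_weight_pos (v : UnitVecs r n) : 0 < ∑ ρ, weight (twist ρ v) := by
  obtain ⟨ρ, hρ⟩ := exists_weight_twist_pos v
  exact Finset.sum_pos' (fun _ _ => weight_nonneg _) ⟨ρ, Finset.mem_univ _, hρ⟩

theorem normWeight_nonneg (v : UnitVecs r n) (ρ : Fin r → ℤˣ) : 0 ≤ normWeight v ρ :=
  div_nonneg (weight_nonneg _) (sum_weight_pos v).le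

theorem sum_normWeight (v : UnitVecs r n) : ∑ ρ, normWeight v ρ = 1 := by
  simp only [normWeight, ← Finset.sum_div]
  exact div_self (sum_weight_pos v).ne'

theorem continuous_normWeight : Continuous (normWeight : UnitVecs r n → _) :=
  continuous_pi fun ρ => (continuous_weight.comp (continuous_twist ρ)).div
    (continuous_finsetSum _ fun ρ' _ => continuous_weight.comp (continuous_twist ρ'))
    fun v => (sum_weight_pos v).ne'

theorem weight_twist_ne_zero {v : UnitVecs r n} {ρ : Fin r → ℤˣ} (h : normWeight v ρ ≠ 0) :
    weight (twist ρ v) ≠ 0 := fun h0 => h (by rw [normWeight, h0, zero_div])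

attribute [irreducible] weight polygon twist

end RP

/-! ### The action of `SO(n)` on vectors and lines -/

theorem blockEmb_transpose {n : ℕ} (A : Matrix (Fin n) (Fin n) ℝ) :
    blockEmb Aᵀ = (blockEmb A)ᵀ := by
  simp [blockEmb, Matrix.fromBlocks_transpose, Matrix.transpose_submatrix]

theorem soLin_dotProduct {n : ℕ} (g : SO n) (v w : Fin (n + 1) → ℝ) :
    soLin g v ⬝ᵥ soLin g w = v ⬝ᵥ w := by
  have h : (blockEmb (g : Matrix (Fin n) (Fin n) ℝ))ᵀ * blockEmb (g : Matrix (Fin n) (Fin n) ℝ)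
      = 1 := by
    have hg : (g : Matrix (Fin n) (Fin n) ℝ)ᵀ * (g : Matrix (Fin n) (Fin n) ℝ) = 1 := by
      have := (Matrix.mem_orthogonalGroup_iff' (Fin n) ℝ).1
        (Matrix.mem_specialOrthogonalGroup_iff.1 g.2).1
      simpa [Matrix.star_eq_conjTranspose] using this
    rw [← blockEmb_transpose, ← blockEmb_mul, hg, blockEmb_one]
  simp only [soLin, Matrix.toLin'_apply]
  rw [Matrix.dotProduct_mulVec, Matrix.vecMul_mulVec, ← Matrix.dotProduct_mulVec, h,
    Matrix.one_mulVec]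

theorem RP.soLin_ne_zero {n : ℕ} (g : SO n) {v : Fin (n + 1) → ℝ} (hv : v ≠ 0) :
    soLin g v ≠ 0 := fun h => hv (soLin_injective g (by rw [h, map_zero]))

theorem RP.smul_ofVec {n : ℕ} (g : SO n) {v : Fin (n + 1) → ℝ} (hv : v ≠ 0) :
    g • (RP.ofVec v : RP n) = RP.ofVec (soLin g v) := by
  rw [RP.ofVec_of_ne hv, RP.ofVec_of_ne (RP.soLin_ne_zero g hv)]
  exact Projectivization.map_mk _ _ _ hv

theorem continuous_soLin {n : ℕ} :
    Continuous fun x : SO n × (Fin (n + 1) → ℝ) => soLin x.1 x.2 := by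
  have h : Continuous (blockEmb : Matrix (Fin n) (Fin n) ℝ → _) :=
    (continuous_id.matrix_fromBlocks continuous_const continuous_const
      continuous_const).matrix_reindex _ _
  have h' : Continuous fun x : SO n × (Fin (n + 1) → ℝ) =>
      blockEmb (x.1 : Matrix (Fin n) (Fin n) ℝ) :=
    h.comp (continuous_subtype_val.comp continuous_fst)
  simp only [soLin, Matrix.toLin'_apply]
  exact h'.matrix_mulVec continuous_snd

theorem RP.continuousAt_comp_unitSection {n : ℕ} {G W : Type*} [TopologicalSpace G]
    [TopologicalSpace W] {F : G × (Fin (n + 1) → ℝ) → W} (hF : Continuous F) (g : G) (x : RP n) :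
    ContinuousAt (fun z : G × RP n => F (z.1, RP.unitSection x.rep z.2)) (g, x) :=
  hF.continuousAt.comp (continuousAt_fst.prodMk
    (ContinuousAt.comp (g := RP.unitSection x.rep)
      (RP.continuousAt_unitSection (RP.rep_dotProduct_rep_ne_zero x)) continuousAt_snd))

theorem RP.continuousAt_smul {n : ℕ} (g : SO n) (x : RP n) :
    ContinuousAt (fun z : SO n × RP n => (z.1 • z.2 : RP n)) (g, x) := by
  have hx := RP.rep_dotProduct_rep_ne_zero x
  have h2 : ContinuousAt (fun z : SO n × RP n => soLin z.1 (RP.unitSection x.rep z.2)) (g, x) :=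
    RP.continuousAt_comp_unitSection continuous_soLin g x
  have h0 := RP.ne_zero_of_dotProduct_self (RP.unitSection_dotProduct_self hx)
  have h3 : ContinuousAt
      (fun z : SO n × RP n => (RP.ofVec (soLin z.1 (RP.unitSection x.rep z.2)) : RP n)) (g, x) :=
    ContinuousAt.comp (g := RP.ofVec) (RP.continuousAt_ofVec (RP.soLin_ne_zero g h0)) h2
  have h4 : (fun z : SO n × RP n => (RP.ofVec (soLin z.1 (RP.unitSection x.rep z.2)) : RP n))
      =ᶠ[nhds (g, x)] fun z : SO n × RP n => (z.1 • z.2 : RP n) := by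
    filter_upwards [((RP.isOpen_dotProduct_ne_zero x.rep).preimage continuous_snd).mem_nhds hx]
      with z hz
    have hz' : z.2.rep ⬝ᵥ x.rep ≠ 0 := hz
    rw [← RP.smul_ofVec _ (RP.ne_zero_of_dotProduct_self (RP.unitSection_dotProduct_self hz')),
      RP.ofVec_unitSection hz']
  exact h3.congr h4

instance (n : ℕ) : ContinuousSMul (SO n) (RP n) :=
  ⟨continuous_iff_continuousAt.2 fun z => RP.continuousAt_smul z.1 z.2⟩

instance (n : ℕ) : ContinuousInv (SO n) := by
  refine ⟨Continuous.subtype_mk (f := fun g : SO n => star (g : Matrix (Fin n) (Fin n) ℝ)) ?_ _⟩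
  exact continuous_subtype_val.matrix_conjTranspose

namespace IsPrincipalBundle

variable {G P B : Type*} [Group G] [TopologicalSpace G] [TopologicalSpace P] [TopologicalSpace B]
  [MulAction G P] {q : P → B}

/-- In a trivialization `g` acts by left translation of the fibre coordinate. This continuity makes
the orbit map of the diagonal action open. -/
theorem continuousConstSMul [ContinuousMul G] (h : IsPrincipalBundle G q) :
    ContinuousConstSMul G P := by
  refine ⟨fun g => continuous_iff_continuousAt.2 fun y => ?_⟩
  obtain ⟨e, hb, he⟩ := h.locally_trivial (q y)
  have hy : y ∈ e.source := e.mem_source.2 hb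
  have hval : ∀ z ∈ e.source, g • z = e.toOpenPartialHomeomorph.symm (q z, g * (e z).2) := by
    intro z hz
    have hz' : g • z ∈ e.source := e.mem_source.2 (by
      rw [h.proj_smul]; exact e.mem_source.1 hz)
    rw [← he g z (e.mem_source.1 hz), ← h.proj_smul g z, e.mk_proj_snd hz']
    exact (e.toOpenPartialHomeomorph.left_inv hz').symm
  have hq : ContinuousAt q y := e.continuousAt_proj hy
  have h2 : ContinuousAt (fun z => (e z).2) y :=
    continuousAt_snd.comp (e.toOpenPartialHomeomorph.continuousAt hy)
  have h3 : ContinuousAt (fun z => (q z, g * (e z).2)) y :=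
    hq.prodMk (continuousAt_const.mul h2)
  have h4 : ContinuousAt (fun z => e.toOpenPartialHomeomorph.symm (q z, g * (e z).2)) y :=
    ContinuousAt.comp (g := e.toOpenPartialHomeomorph.symm)
      (e.toOpenPartialHomeomorph.continuousAt_symm (e.mem_target.2 hb)) h3
  refine h4.congr ?_
  filter_upwards [e.open_source.mem_nhds hy] with z hz
  exact (hval z hz).symm

variable {F E : Type*} [TopologicalSpace F] [MulAction G F] [TopologicalSpace E]

/-- The associated bundle has local sections to `F × P` whose second component only depends on the
point of the base. -/
theorem exists_local_section [ContinuousInv G] [ContinuousSMul G F] (h : IsPrincipalBundle G q)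
    {mk : F × P → E} (hmk : IsOpenQuotientMap mk)
    (heq : ∀ z z', mk z = mk z' ↔ ∃ g : G, g • z = z') (y₀ : P) :
    ∃ (L : E → F × P) (O : Set E), IsOpen O ∧ (∀ x (g : G), mk (x, g • y₀) ∈ O) ∧
      ContinuousOn L O ∧ (∀ c ∈ O, mk (L c) = c) ∧
      ∀ x x' y y' (g : G), g • y = y' → (L (mk (x, y))).2 = (L (mk (x', y'))).2 := by
  obtain ⟨e, hb, he⟩ := h.locally_trivial (q y₀)
  -- The representative of the orbit whose fibre coordinate is 1. It is constant on orbits, so it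
  -- descends, and composing with an arbitrary set-theoretic section `R` loses no continuity.
  set κ : F × P → F × P := fun z =>
    ((e z.2).2⁻¹ • z.1, e.toOpenPartialHomeomorph.symm (q z.2, 1)) with hκ
  have hqrep : ∀ z z', mk z = mk z' → q z.2 = q z'.2 := by
    intro z z' hz
    obtain ⟨g, rfl⟩ := (heq z z').1 hz
    exact (h.proj_smul g z.2).symm
  have hκinv : ∀ z z', mk z = mk z' → q z.2 ∈ e.baseSet → κ z = κ z' := by
    intro z z' hz hzb
    obtain ⟨g, rfl⟩ := (heq z z').1 hz
    simp only [hκ, Prod.smul_fst, Prod.smul_snd, h.proj_smul, he g z.2 hzb, mul_inv_rev, mul_smul,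
      inv_smul_smul]
  choose R hR using hmk.surjective
  refine ⟨fun c => κ (R c), {c | q (R c).2 ∈ e.baseSet}, ?_, ?_, ?_, ?_, ?_⟩
  · rw [← hmk.isQuotientMap.isOpen_preimage]
    have : mk ⁻¹' {c | q (R c).2 ∈ e.baseSet} = Prod.snd ⁻¹' e.source := by
      ext z
      rw [mem_preimage, mem_ofPred_eq, hqrep _ _ (hR (mk z)), mem_preimage, e.mem_source]
    rw [this]
    exact e.open_source.preimage continuous_snd
  · intro x g
    rw [mem_ofPred_eq, hqrep _ _ (hR (mk (x, g • y₀))), h.proj_smul]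
    exact hb
  · rw [hmk.isQuotientMap.continuousOn_isOpen_iff]
    · have hpre : ∀ z ∈ mk ⁻¹' {c | q (R c).2 ∈ e.baseSet}, q z.2 ∈ e.baseSet := by
        intro z hz
        rw [← hqrep _ _ (hR (mk z))]
        exact hz
      have h1 : ContinuousOn κ (mk ⁻¹' {c | q (R c).2 ∈ e.baseSet}) := by
        intro z hz
        refine ContinuousAt.continuousWithinAt ?_
        have hz' : z.2 ∈ e.source := e.mem_source.2 (hpre z hz)
        have h2 : ContinuousAt (fun z : F × P => (e z.2).2) z :=
          continuousAt_snd.comp (ContinuousAt.comp (g := e)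
            (e.toOpenPartialHomeomorph.continuousAt hz') continuousAt_snd)
        have h3 : ContinuousAt (fun z : F × P => q z.2) z :=
          ContinuousAt.comp (g := q) (e.continuousAt_proj hz') continuousAt_snd
        exact (h2.inv.smul continuousAt_fst).prodMk (ContinuousAt.comp
          (g := fun b => e.toOpenPartialHomeomorph.symm (b, 1))
          (e.continuousAt_symm_prodMk_left (hpre z hz)) h3)
      refine h1.congr fun z hz => ?_
      refine hκinv _ _ (hR (mk z)) ?_
      rw [hqrep _ _ (hR (mk z))]
      exact hpre z hz
    · rw [← hmk.isQuotientMap.isOpen_preimage]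
      have : mk ⁻¹' {c | q (R c).2 ∈ e.baseSet} = Prod.snd ⁻¹' e.source := by
        ext z
        rw [mem_preimage, mem_ofPred_eq, hqrep _ _ (hR (mk z)), mem_preimage, e.mem_source]
      rw [this]
      exact e.open_source.preimage continuous_snd
  · intro c hc
    have hc' : q (R c).2 ∈ e.baseSet := hc
    have hs : (e (R c).2).2⁻¹ • (R c).2 ∈ e.source := e.mem_source.2 (by rwa [h.proj_smul])
    have : κ (R c) = (e (R c).2).2⁻¹ • R c := by
      refine Prod.ext rfl ?_
      have h1 := e.mk_proj_snd hs
      rw [h.proj_smul, he _ _ hc', inv_mul_cancel] at h1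
      simp only [hκ, Prod.smul_snd, h1]
      exact e.toOpenPartialHomeomorph.left_inv hs
    change mk (κ (R c)) = c
    rw [this]
    refine Eq.trans ?_ (hR c)
    exact ((heq _ _).2 ⟨(e (R c).2).2⁻¹, rfl⟩).symm
  · rintro x x' y y' g rfl
    simp only [hκ, hqrep _ _ (hR (mk (x, y))), hqrep _ _ (hR (mk (x', g • y))), h.proj_smul]

end IsPrincipalBundle

/-! ### The upper bound for the parametrized distributional complexity -/

namespace RP

variable {r n : ℕ}

/-- A unit vector on the given line, depending continuously on the line near `[w]`. -/
noncomputable def unitLift (w : Fin (n + 1) → ℝ) (x : RP n) : {v : Fin (n + 1) → ℝ // v ⬝ᵥ v = 1} :=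
  open Classical in
  if h : x.rep ⬝ᵥ w ≠ 0 then ⟨unitSection w x, unitSection_dotProduct_self h⟩
  else ⟨unitSection x.rep x, unitSection_dotProduct_self (rep_dotProduct_rep_ne_zero x)⟩

theorem ofVec_unitLift (w : Fin (n + 1) → ℝ) (x : RP n) : ofVec (unitLift w x).1 = x := by
  unfold unitLift
  split_ifs with h
  · exact ofVec_unitSection h
  · exact ofVec_unitSection (rep_dotProduct_rep_ne_zero x)

theorem continuousAt_unitLift (x : RP n) : ContinuousAt (unitLift x.rep) x := by
  have hind : Topology.IsInducing
      (Subtype.val : {v : Fin (n + 1) → ℝ // v ⬝ᵥ v = 1} → Fin (n + 1) → ℝ) := ⟨rfl⟩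
  rw [hind.continuousAt_iff]
  refine (continuousAt_unitSection (rep_dotProduct_rep_ne_zero x)).congr ?_
  filter_upwards [(isOpen_dotProduct_ne_zero x.rep).mem_nhds (rep_dotProduct_rep_ne_zero x)]
    with z hz
  simp only [Function.comp_apply, unitLift]
  rw [dif_pos hz]

theorem unitVec_ne_zero (v : {v : Fin (n + 1) → ℝ // v ⬝ᵥ v = 1}) : v.1 ≠ 0 :=
  ne_zero_of_dotProduct_self v.2

theorem weight_congr {w w' : UnitVecs r n}
    (h : ∀ i j, (w' i).1 ⬝ᵥ (w' j).1 = (w i).1 ⬝ᵥ (w j).1) : weight w' = weight w := by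
  unfold weight
  simp only [h]

theorem polygon_soLin (g : SO n) {w w' : UnitVecs r n} (h : ∀ i, (w' i).1 = soLin g (w i).1)
    (t : I) : polygon w' t = soLin g (polygon w t) := by
  simp only [polygon, h, map_sum, map_smul]

variable {P E B : Type*} [TopologicalSpace P] [MetricSpace E] {p : E → B} {mk : RP n × P → E}
  {β : P → B}

/-- The path in a fibre of `p` through the classes of the given vectors. -/
noncomputable def fiberPath (hmk : Continuous mk) (hβ : ∀ x y, p (mk (x, y)) = β y)
    (z : UnitVecs r n × P) : FiberwisePath p :=
  open Classical in
  ⟨if h : ∀ t, polygon z.1 t ≠ 0 then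
    ⟨fun t => mk (ofVec (polygon z.1 t), z.2), hmk.comp ((continuousOn_ofVec.comp_continuous
      (continuous_polygon.comp (Continuous.prodMk_right z.1)) h).prodMk continuous_const)⟩
    -- For `r ≥ 2` this default occurs only at weight zero, where it carries no mass.
    else ContinuousMap.const I (mk (basePoint n, z.2)), β z.2, fun t => by
      split_ifs
      · exact hβ _ _
      · exact hβ _ _⟩

theorem fiberPath_apply (hr : 2 ≤ r) (hmk : Continuous mk) (hβ : ∀ x y, p (mk (x, y)) = β y)
    {z : UnitVecs r n × P} (hz : weight z.1 ≠ 0) (t : I) :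
    (fiberPath hmk hβ z).1 t = mk (ofVec (polygon z.1 t), z.2) := by
  have h : ∀ t, polygon z.1 t ≠ 0 := polygon_ne_zero hr hz
  simp only [fiberPath, dif_pos h]
  rfl

attribute [irreducible] fiberPath

theorem continuousAt_fiberPath (hr : 2 ≤ r) (hmk : Continuous mk)
    (hβ : ∀ x y, p (mk (x, y)) = β y) {z : UnitVecs r n × P} (hz : weight z.1 ≠ 0) :
    ContinuousAt (fiberPath hmk hβ) z := by
  have hind : Topology.IsInducing (Subtype.val : FiberwisePath p → C(I, E)) := ⟨rfl⟩
  rw [hind.continuousAt_iff]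
  have hopen : IsOpen {z : UnitVecs r n × P | weight z.1 ≠ 0} :=
    isOpen_ne_fun (continuous_weight.comp continuous_fst) continuous_const
  refine ContinuousOn.continuousAt (s := {z : UnitVecs r n × P | weight z.1 ≠ 0}) ?_
    (hopen.mem_nhds hz)
  apply ContinuousMap.continuousOn_of_continuousOn_uncurry
  have h1 : ContinuousOn (fun x : (UnitVecs r n × P) × I => mk (ofVec (polygon x.1.1 x.2), x.1.2))
      ({z : UnitVecs r n × P | weight z.1 ≠ 0} ×ˢ univ) := by
    refine hmk.comp_continuousOn (ContinuousOn.prodMk ?_ (by fun_prop))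
    refine continuousOn_ofVec.comp (Continuous.continuousOn ?_) ?_
    · exact continuous_polygon.comp
        ((continuous_fst.comp continuous_fst).prodMk continuous_snd)
    · rintro ⟨z, t⟩ ⟨hz, -⟩
      exact polygon_ne_zero hr hz t
  refine h1.congr ?_
  rintro ⟨z, t⟩ ⟨hz, -⟩
  exact fiberPath_apply hr hmk hβ hz t

/-- The random path through the lines spanned by the given vectors. -/
noncomputable def randomPath {k : ℕ} (hk : 2 ^ r ≤ k) (hmk : Continuous mk)
    (hβ : ∀ x y, p (mk (x, y)) = β y) (z : UnitVecs r n × P) : FinProb k (FiberwisePath p) :=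
  -- Opposite sign choices give the same path, so `2 ^ (r - 1)` atoms would do; the cruder count
  -- suffices.
  FinProb.ofSum (ι := Fin r → ℤˣ) (by simpa using hk) (normWeight z.1)
    (fun ρ => fiberPath hmk hβ (twist ρ z.1, z.2)) (normWeight_nonneg z.1) (sum_normWeight z.1)

theorem toMeasure_randomPath {k : ℕ} (hk : 2 ^ r ≤ k) (hmk : Continuous mk)
    (hβ : ∀ x y, p (mk (x, y)) = β y) (z : UnitVecs r n × P) :
    @ProbabilityMeasure.toMeasure _ (borel _) (randomPath hk hmk hβ z).1 =
      FinProb.sumDirac (normWeight z.1) fun ρ => fiberPath hmk hβ (twist ρ z.1, z.2) := rfl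

theorem continuous_randomPath {k : ℕ} (hk : 2 ^ r ≤ k) (hr : 2 ≤ r) (hmk : Continuous mk)
    (hβ : ∀ x y, p (mk (x, y)) = β y) : Continuous (randomPath hk hmk hβ) := by
  refine continuous_iff_continuousAt.2 fun z => ?_
  refine FinProb.continuousAt_of_eq_sumDirac _ (fun z => normWeight z.1)
    (fun z ρ => fiberPath hmk hβ (twist ρ z.1, z.2)) (toMeasure_randomPath hk hmk hβ) z
    (normWeight_nonneg z.1)
    (continuous_normWeight.comp continuous_fst).continuousAt fun ρ hρ => ?_
  have h1 : Continuous fun z : UnitVecs r n × P => (twist ρ z.1, z.2) :=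
    ((continuous_twist ρ).comp continuous_fst).prodMk continuous_snd
  exact ContinuousAt.comp (g := fiberPath hmk hβ)
    (continuousAt_fiberPath hr hmk hβ (weight_twist_ne_zero hρ)) h1.continuousAt

theorem endpointMap_of_mem_supp {k : ℕ} (hk : 2 ^ r ≤ k) (hr : 2 ≤ r) (hmk : Continuous mk)
    (hβ : ∀ x y, p (mk (x, y)) = β y) (z : UnitVecs r n × P) {γ : FiberwisePath p}
    (hγ : γ ∈ (randomPath hk hmk hβ z).supp) (i : Fin r) :
    (endpointMap r p γ).1 i = mk (ofVec (z.1 i).1, z.2) := by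
  obtain ⟨ρ, hρ, rfl⟩ := FinProb.exists_of_mem_supp_ofSum _ _ _ _ _ hγ
  have h := fiberPath_apply hr hmk hβ (z := (twist ρ z.1, z.2)) (weight_twist_ne_zero hρ)
    (sampleTime r i)
  refine h.trans ?_
  dsimp only
  rw [polygon_sampleTime hr, twist_val, ofVec_smul (unit_cast_ne_zero _)]

variable [MulAction (SO n) P]

/-- The vectors `v' i` are `τ i • g v i` for signs `τ`. The reindexing `ρ ↦ ρ * τ` matches weights,
because `g` is an isometry, and paths, because `g` is linear and the diagonal action is divided out.
-/
theorem randomPath_eq {k : ℕ} (hk : 2 ^ r ≤ k) (hr : 2 ≤ r) (hmk : Continuous mk)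
    (hβ : ∀ x y, p (mk (x, y)) = β y) (heq : ∀ z z', mk z = mk z' ↔ ∃ g : SO n, g • z = z')
    (g : SO n) (y : P) {v v' : UnitVecs r n} (hv : ∀ i, ofVec (v' i).1 = g • ofVec (v i).1) :
    randomPath hk hmk hβ (v', g • y) = randomPath hk hmk hβ (v, y) := by
  have hsign : ∀ i, ∃ τ : ℤˣ, (v' i).1 = ((τ : ℤ) : ℝ) • soLin g (v i).1 := by
    intro i
    have h1 := hv i
    rw [smul_ofVec g (unitVec_ne_zero _)] at h1
    obtain ⟨c, -, hc⟩ := (ofVec_eq_iff (unitVec_ne_zero _)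
      (soLin_ne_zero g (unitVec_ne_zero _))).1 h1
    have h2 := (v' i).2
    rw [hc, smul_dotProduct, dotProduct_smul, soLin_dotProduct, (v i).2, smul_eq_mul, smul_eq_mul,
      mul_one, mul_self_eq_one_iff] at h2
    rcases h2 with rfl | rfl
    · exact ⟨1, by simpa using hc⟩
    · exact ⟨-1, by simpa using hc⟩
  choose τ hτ using hsign
  have htw : ∀ (ρ : Fin r → ℤˣ) i,
      (twist ρ v' i).1 = soLin g (twist (ρ * τ) v i).1 := by
    intro ρ i
    simp only [twist_val, hτ, map_smul, smul_smul, Pi.mul_apply, Units.val_mul, Int.cast_mul]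
  have hw : ∀ ρ : Fin r → ℤˣ, weight (twist ρ v') = weight (twist (ρ * τ) v) := by
    intro ρ
    refine weight_congr fun i j => ?_
    rw [htw, htw, soLin_dotProduct]
  have hsum : ∑ ρ, weight (twist ρ v') = ∑ ρ, weight (twist ρ v) := by
    simp only [hw]
    exact Fintype.sum_equiv (Equiv.mulRight τ) _ _ fun ρ => rfl
  refine FinProb.ofSum_congr _ _ _ _ _ (Equiv.mulRight τ) (fun ρ => ?_) fun ρ hρ => ?_
  · rw [normWeight, normWeight, hsum, hw, Equiv.coe_mulRight]
  · have h1 : weight (twist (ρ * τ) v) ≠ 0 := weight_twist_ne_zero hρ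
    have h2 : weight (twist ρ v') ≠ 0 := by rwa [hw]
    refine Subtype.ext (ContinuousMap.ext fun t => ?_)
    have e1 := fiberPath_apply hr hmk hβ (z := (twist (ρ * τ) v, y)) h1 t
    have e2 := fiberPath_apply hr hmk hβ (z := (twist ρ v', g • y)) h2 t
    refine e2.trans (Eq.trans ?_ e1.symm)
    dsimp only
    rw [polygon_soLin g (htw ρ), ← smul_ofVec g (polygon_ne_zero hr h1 t)]
    exact ((heq (ofVec (polygon (twist (ρ * τ) v) t), y)
      (g • ofVec (polygon (twist (ρ * τ) v) t), g • y)).2 ⟨g, Prod.smul_mk _ _ _⟩).symm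

/-- Principal `SO(n)`-bundles have `ℝPⁿ`-associates with `dTC_r ≤ 2 ^ r - 1`. -/
theorem parametrizedDTC_le {B' : Type*} [TopologicalSpace B'] {q : P → B'}
    (hq : IsPrincipalBundle (SO n) q) {k : ℕ} (hk : 2 ^ r ≤ k + 1) (hr : 2 ≤ r)
    (hmk : IsOpenQuotientMap mk)
    (hβ : ∀ x y, p (mk (x, y)) = β y) (heq : ∀ z z', mk z = mk z' ↔ ∃ g : SO n, g • z = z')
    (hβ' : ∀ y y', β y = β y' → ∃ g : SO n, g • y = y') :
    parametrizedDTC r p ≤ (k : ℕ∞) := by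
  set i₀ : Fin r := ⟨0, by omega⟩
  have hloc : ∀ e₀ : FiberProduct r p, ∃ L : FiberProduct r p → UnitVecs r n × P,
      ContinuousAt L e₀ ∧ ∀ᶠ e in nhds e₀, ∀ i, mk (ofVec ((L e).1 i).1, (L e).2) = e.1 i := by
    intro e₀
    obtain ⟨⟨x₀, y₀⟩, hxy⟩ := hmk.surjective (e₀.1 i₀)
    obtain ⟨L, O, hO, hmem, hL, hmkL, hsnd⟩ := hq.exists_local_section hmk heq y₀
    have hrepr : ∀ e : FiberProduct r p, ∀ i, ∃ x y x' y', ∃ g : SO n,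
        g • y = y' ∧ mk (x, y) = e.1 i₀ ∧ mk (x', y') = e.1 i := by
      intro e i
      obtain ⟨⟨x, y⟩, h1⟩ := hmk.surjective (e.1 i₀)
      obtain ⟨⟨x', y'⟩, h2⟩ := hmk.surjective (e.1 i)
      have h3 := e.2 i₀ i
      rw [← h1, ← h2, hβ, hβ] at h3
      obtain ⟨g, hg⟩ := hβ' _ _ h3
      exact ⟨x, y, x', y', g, hg, h1, h2⟩
    have he₀ : ∀ i, e₀.1 i ∈ O := by
      intro i
      obtain ⟨⟨x', y'⟩, h2⟩ := hmk.surjective (e₀.1 i)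
      have h3 := e₀.2 i₀ i
      rw [← hxy, ← h2, hβ, hβ] at h3
      obtain ⟨g, rfl⟩ := hβ' _ _ h3
      rw [← h2]
      exact hmem x' g
    have hLi : ∀ i, ContinuousAt (fun e : FiberProduct r p => L (e.1 i)) e₀ := fun i =>
      ContinuousAt.comp (g := L) (hL.continuousAt (hO.mem_nhds (he₀ i)))
        ((continuous_apply i).comp continuous_subtype_val).continuousAt
    refine ⟨fun e => (fun i => unitLift (L (e₀.1 i)).1.rep (L (e.1 i)).1, (L (e.1 i₀)).2),
      ContinuousAt.prodMk (continuousAt_pi.2 fun i => ?_) (continuousAt_snd.comp (hLi i₀)), ?_⟩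
    · exact ContinuousAt.comp (g := unitLift (L (e₀.1 i)).1.rep)
        (f := fun e : FiberProduct r p => (L (e.1 i)).1) (continuousAt_unitLift _)
        (continuousAt_fst.comp (hLi i))
    · have hev : ∀ᶠ e : FiberProduct r p in nhds e₀, ∀ i, e.1 i ∈ O := by
        rw [Filter.eventually_all]
        intro i
        exact (hO.preimage ((continuous_apply i).comp continuous_subtype_val)).mem_nhds (he₀ i)
      filter_upwards [hev] with e he i
      obtain ⟨x, y, x', y', g, hg, h1, h2⟩ := hrepr e i
      have := hsnd x x' y y' g hg
      rw [h1, h2] at this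
      simp only [ofVec_unitLift, this]
      exact hmkL _ (he i)
  have hlift : ∀ e : FiberProduct r p, ∃ z : UnitVecs r n × P,
      ∀ i, mk (ofVec (z.1 i).1, z.2) = e.1 i := fun e => by
    obtain ⟨L, -, hL⟩ := hloc e
    exact ⟨L e, hL.self_of_nhds⟩
  choose Z hZ using hlift
  have hinv : ∀ z z' : UnitVecs r n × P,
      (∀ i, mk (ofVec (z.1 i).1, z.2) = mk (ofVec (z'.1 i).1, z'.2)) →
      randomPath hk hmk.continuous hβ z' = randomPath hk hmk.continuous hβ z := by
    rintro ⟨v, y⟩ ⟨v', y'⟩ hz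
    have hg : ∀ i, ∃ g : SO n, g • (ofVec (v i).1 : RP n) = ofVec (v' i).1 ∧ g • y = y' := by
      intro i
      obtain ⟨g, hg⟩ := (heq _ _).1 (hz i)
      exact ⟨g, congrArg Prod.fst hg, congrArg Prod.snd hg⟩
    choose g hg1 hg2 using hg
    -- Freeness of the action on `P` forces one group element to serve all entries.
    have hgi : ∀ i, g i = g i₀ := by
      intro i
      have h1 : ((g i₀)⁻¹ * g i) • y = y := by
        rw [mul_smul, hg2 i, ← hg2 i₀, inv_smul_smul]
      exact (inv_mul_eq_one.1 (hq.eq_one_of_smul_eq h1)).symm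
    rw [← hg2 i₀]
    refine randomPath_eq hk hr hmk.continuous hβ heq (g i₀) y fun i => ?_
    rw [← hg1 i, hgi i]
  -- `Z` is an arbitrary lift; since the measure does not depend on the lift, continuity is checked
  -- with the local lifts of `hloc`.
  refine sInf_le ⟨k, rfl, ⟨fun e => randomPath hk hmk.continuous hβ (Z e), ?_⟩, ?_⟩
  · refine continuous_iff_continuousAt.2 fun e₀ => ?_
    obtain ⟨L, hLc, hL⟩ := hloc e₀
    have h1 : ContinuousAt (fun e => randomPath hk hmk.continuous hβ (L e)) e₀ :=
      (continuous_randomPath hk hr hmk.continuous hβ).continuousAt.comp hLc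
    refine h1.congr ?_
    filter_upwards [hL] with e he
    exact hinv _ _ fun i => by rw [hZ, he]
  · intro e γ hγ
    refine Subtype.ext (funext fun i => ?_)
    rw [endpointMap_of_mem_supp hk hr hmk.continuous hβ (Z e) hγ i, hZ]

end RP

theorem mainTheorem8 (r : ℕ) (hr : 2 ≤ r) :
    ∃ nr : ℕ, ∀ n : ℕ, 1 ≤ n →
      ∀ (P : Type*) (B : Type*) [TopologicalSpace P] [TopologicalSpace B] [Nonempty P]
        [MulAction (SO n) P] (q : P → B), IsPrincipalBundle (SO n) q →
      ∀ d : MetricSpace (RPAssoc n P),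
        d.toPseudoMetricSpace.toUniformSpace.toTopologicalSpace =
          (instTopologicalSpaceQuotient : TopologicalSpace (RPAssoc n P)) →
        @parametrizedDTC _ _ d r (rpAssocProj n P) ≤ ((2 ^ (2 * r - 2) - 1 : ℕ) : ℕ∞) ∧
        ((n * (r - 1) : ℕ) : ℕ∞) ≤ parametrizedTC r (rpAssocProj n P) ∧
        (nr < n → @parametrizedDTC _ _ d r (rpAssocProj n P) <
          parametrizedTC r (rpAssocProj n P)) := by
  -- For `n` beyond this value, `n * (r - 1) ≥ n > 2 ^ (2 * r - 2) - 1`, so the two bounds separate.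
  refine ⟨2 ^ (2 * r - 2), fun n _ P B _ _ _ _ q hq d hd => ?_⟩
  have hpow : 2 ^ r ≤ 2 ^ (2 * r - 2) := Nat.pow_le_pow_right (by norm_num) (by omega)
  have hpos : 0 < 2 ^ (2 * r - 2) := by positivity
  have hupper : @parametrizedDTC _ _ d r (rpAssocProj n P) ≤
      ((2 ^ (2 * r - 2) - 1 : ℕ) : ℕ∞) := by
    have : ContinuousConstSMul (SO n) P := hq.continuousConstSMul
    have hopen : IsOpenQuotientMap
        (Quotient.mk (MulAction.orbitRel (SO n) (RP n × P)) : _ → RPAssoc n P) :=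
      MulAction.isOpenQuotientMap_quotientMk
    rw [← hd] at hopen
    refine RP.parametrizedDTC_le (mk := Quotient.mk (MulAction.orbitRel (SO n) (RP n × P)))
      (β := fun y => Quotient.mk _ y) hq (by omega) hr hopen (fun x y => rfl) (fun z z' => ?_)
      fun y y' h => ?_
    · refine Quotient.eq.trans ⟨fun h => ?_, fun ⟨g, hg⟩ => ⟨g⁻¹, by simp [← hg]⟩⟩
      obtain ⟨g, hg⟩ := h
      exact ⟨g⁻¹, by simp [← hg]⟩
    · obtain ⟨g, hg⟩ := Quotient.exact h
      exact ⟨g⁻¹, by simp [← hg]⟩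
  have hlower : ((n * (r - 1) : ℕ) : ℕ∞) ≤ parametrizedTC r (rpAssocProj n P) := by
    obtain ⟨y⟩ := ‹Nonempty P›
    have hT2 : T2Space (RPAssoc n P) := by
      rw [← hd]
      infer_instance
    obtain ⟨k, rfl⟩ : ∃ k, r = k + 1 := ⟨r - 1, by omega⟩
    exact RP.le_parametrizedTC (rpAssocProj n P)
      ⟨fun x => Quotient.mk _ (x, y), continuous_mk_left y⟩ (hq.mk_injective y) (Quotient.mk _ y)
      (fun _ => rfl) fun e he => mem_range_mk_of_assocProj_eq y e he
  refine ⟨hupper, hlower, fun hn => lt_of_le_of_lt hupper (lt_of_lt_of_le ?_ hlower)⟩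
  rw [Nat.cast_lt]
  have : n ≤ n * (r - 1) := Nat.le_mul_of_pos_right n (by omega)
  omega
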